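/- Lemma 1.3 (Absorbing Lemma). For integers $1\le a\le b\le c$ put $d=\gcd(b-a,c-b)$ (so $d=0$ if $a=b=c$) and \[ f(a,b,c)=\begin{cases} 1/4, & \text{if } a=1,\ \gcd(a,b,c)=1 \text{ and } d=1;\\ 6-4\sqrt2, & \text{if } a\ge 2,\ \gcd(a,b,c)=1 \text{ and } d=1;\\ 4/9, & \text{if } \gcd(a,b,c)=1 \text{ and } d\ge 3 \text{ is odd};\\ 1/2, & \text{otherwise.} \end{cases} \] A 3-graph $H$ is a 3-uniform hypergraph: a finite vertex set $V(H)$ with a set of 3-element subsets of $V(H)$, called edges. Let $\delta_1(H)$ be the minimum, over all vertices $v$, of the number of edges containing $v$; for $S\subseteq V(H)$ let $H[S]$ be the 3-graph with vertex set $S$ whose edges are the edges of $H$ contained in $S$. Let $K_{a,b,c}$ be the complete 3-partite 3-graph with parts of sizes $a,b,c$, whose edges are all triples with exactly one vertex in each part. A $K_{a,b,c}$-factor of a 3-graph is a collection of pairwise vertex-disjoint (not necessarily induced) copies of $K_{a,b,c}$ in it that covers all of its vertices. Fix integers $1\le a\le b\le c$. For every $\gamma>0$ there exist $\alpha>0$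 and $n_0\in\mathbb N$ such that for all $n\ge n_0$ the following holds. Let $H$ be a 3-graph on $n$ vertices with \[ \delta_1(H)\ge \bigl(f(a,b,c)+\gamma\bigr)\binom n2 . \] Then there is a set $W\subseteq V(H)$ with $|W|\le \tfrac14\gamma n$ such that for every $U\subseteq V(H)\setminus W$ with $|U|\le\alpha n$ and $|U|$ divisible by $a+b+c$, both $H[W]$ and $H[W\cup U]$ have $K_{a,b,c}$-factors. -/

import Mathlib

/-- An `r`-uniform hypergraph (`r`-graph) with vertex set `V`: a set of `r`-element subsets of `V`. -/
structure UniformHypergraph (r : ℕ) (V : Type*) where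
  /-- The set of edges. -/
  edges : Set (Finset V)
  /-- Every edge has exactly `r` vertices. -/
  card_eq : ∀ e ∈ edges, e.card = r

namespace UniformHypergraph

variable {r : ℕ} {U V : Type*}

/-- The degree of a set `S` of vertices: the number of edges that contain `S`. -/
noncomputable def degree (H : UniformHypergraph r V) (S : Finset V) : ℕ :=
  {e | e ∈ H.edges ∧ S ⊆ e}.ncard

/-- The minimum `d`-degree: the minimum of the degrees of all `d`-element vertex sets.
(For `d = 1` and a nonempty finite `V` this is a minimum over a finite nonempty family.) -/
noncomputable def minDegree (H : UniformHypergraph r V) (d : ℕ) : ℕ :=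
  ⨅ S : {S : Finset V // S.card = d}, H.degree S.1

/-- The subhypergraph `H[W]` induced by a vertex set `W`: its vertices are the elements of `W`,
its edges are the edges of `H` all of whose vertices lie in `W`. -/
def induce (H : UniformHypergraph r V) (W : Finset V) :
    UniformHypergraph r {x : V // x ∈ W} where
  edges := {e | e.map (Function.Embedding.subtype fun x => x ∈ W) ∈ H.edges}
  card_eq e he := by simpa using H.card_eq _ he

/-- A copy of `F` in `H` (not necessarily induced): an injection of the vertices of `F` into
those of `H` that maps edges to edges. -/
structure Copy (F : UniformHypergraph r U) (H : UniformHypergraph r V) where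
  /-- The placement of the vertices. -/
  toEmbedding : U ↪ V
  /-- Edges of `F` are mapped to edges of `H`. -/
  map_mem : ∀ e ∈ F.edges, e.map toEmbedding ∈ H.edges

/-- The set of vertices of `H` covered by a copy of `F`. -/
def Copy.support {F : UniformHypergraph r U} {H : UniformHypergraph r V} (φ : Copy F H) :
    Set V :=
  Set.range φ.toEmbedding

/-- An `F`-tiling of `H`: a collection of pairwise vertex-disjoint copies of `F` in `H`. -/
def IsTiling {F : UniformHypergraph r U} {H : UniformHypergraph r V} (T : Set (Copy F H)) :
    Prop :=
  T.PairwiseDisjoint Copy.support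

/-- `H` has an `F`-factor: an `F`-tiling that covers all vertices of `H`. -/
def HasFactor (F : UniformHypergraph r U) (H : UniformHypergraph r V) : Prop :=
  ∃ T : Set (Copy F H), IsTiling T ∧ ⋃ φ ∈ T, φ.support = Set.univ

/-- The complete `3`-partite `3`-graph `K_{a,b,c}`: its vertex set is the disjoint union of parts
of sizes `a`, `b`, `c`, and its edges are all triples with exactly one vertex in each part. -/
def completeTripartite (a b c : ℕ) : UniformHypergraph 3 (Fin a ⊕ Fin b ⊕ Fin c) where
  edges := {e | ∃ (x : Fin a) (y : Fin b) (z : Fin c),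
    e = {Sum.inl x, Sum.inr (Sum.inl y), Sum.inr (Sum.inr z)}}
  card_eq := by
    rintro e ⟨x, y, z, rfl⟩
    exact Finset.card_eq_three.2 ⟨_, _, _, by simp, by simp, by simp, rfl⟩

end UniformHypergraph

/-- The threshold density `f(a,b,c)`, for `a ≤ b ≤ c` (so that the subtractions of natural numbers
do not truncate); here `gcd (b - a) (c - b)` is `0` when `a = b = c`. -/
noncomputable def absorbingDensity (a b c : ℕ) : ℝ :=
  if a = 1 ∧ Nat.gcd (Nat.gcd a b) c = 1 ∧ Nat.gcd (b - a) (c - b) = 1 then 1 / 4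
  else if 2 ≤ a ∧ Nat.gcd (Nat.gcd a b) c = 1 ∧ Nat.gcd (b - a) (c - b) = 1 then
    6 - 4 * Real.sqrt 2
  else if Nat.gcd (Nat.gcd a b) c = 1 ∧ 3 ≤ Nat.gcd (b - a) (c - b) ∧
      Odd (Nat.gcd (b - a) (c - b)) then 4 / 9
  else 1 / 2

/-!
# An absorbing set for tilings with complete tripartite `3`-graphs

The edges of the `3`-graph are viewed as a symmetric ternary relation `E`, in which all links have
density at least `f(a,b,c) + γ / 2`. All counting is done with `density`, the probability that a
random tuple of vertices has a property, and all factors are multisets: `tileable E a b c` consists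
of the sums of blocks `X + Y + Z` whose transversal triples are edges. Repetitions are allowed, so
that tileable multisets form a submonoid and no disjointness has to be tracked. A tileable multiset
without repetitions is a vertex set with a factor (`UniformHypergraph.hasFactor_induce`), and
repetitions are only avoided in the final choice of the absorbing set.

Two multisets are exchangeable (`Exch`) if a positive proportion of the tuples of some bounded
length completes both of them to a tileable multiset. The proof has three parts.

* Every vertex is in many blocks (`exists_density_block_at`). If `a = 1`, its link contains many
  complete bipartite graphs. If `a ≥ 2`, the link must contain many pairs of large codegree. These
  pairs have density at least about `1 - (6 - 4 * √2)` by a special case of the theorem of Füredi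
  and Zhao on shadows (`le_density_of_triangles`), so that they meet every link.

* Almost all pairs of vertices are exchangeable (`mostPairsExch_absorbingDensity`). At density `1/2`
  almost all pairs share many link pairs of large codegree, and one vertex replaces the other one in
  blocks through these pairs. In the other cases it suffices, by an expansion argument
  (`CutsAreCrossed.mostPairsExch`), that every cut into two large sides is crossed by many
  exchangeable pairs. If `b - a` and `c - b` are coprime, then two complete tripartite graphs whose
  part sizes differ by moving one vertex to another part are both tileable, so that most pairs in
  edges are exchangeable, and at density `1/4` edges cross every cut
  (`cutsAreCrossed_of_coprime`). If their greatest common divisor is odd and the density is `4/9`,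
  then either there are exchangeable pairs across the cut because of common links, or almost all
  pairs on the same side are exchangeable; in the second case two types of edges are frequent, and
  combinations of blocks of these types whose numbers of vertices on one side differ by exactly one
  give exchangeable pairs across the cut (`cutsAreCrossed_of_odd`).

* Every `(a+b+c)`-set `T` is absorbed by many tuples (`MostPairsExch.absorbing`): put each vertex of
  `T` into a block and exchange its partners in these blocks with the vertices of further blocks. A
  multiplicative weights argument then selects disjoint absorbing sets, linearly many for each `T`
  (`exists_absorbing_family`, `exists_absorbing_set`). Their union is the set `W`, and a set `U` is
  absorbed by splitting it into `(a+b+c)`-sets and choosing different absorbing sets for them.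
-/

open Finset
open scoped BigOperators

universe u

/-! ### Densities on finite types -/

section Density

variable {Ω Ω' A B : Type*} [Fintype Ω] [Fintype Ω'] [Fintype A] [Fintype B]

open Classical in
/-- The proportion of the elements of a finite type that satisfy `p`. -/
noncomputable def density (p : Ω → Prop) : ℝ := 𝔼 x, if p x then (1 : ℝ) else 0

lemma density_nonneg (p : Ω → Prop) : 0 ≤ density p :=
  expect_nonneg fun x _ => by split_ifs <;> norm_num

lemma density_mono {p q : Ω → Prop} (h : ∀ x, p x → q x) : density p ≤ density q := by
  refine expect_le_expect fun x _ => ?_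
  by_cases hp : p x
  · simp [hp, h x hp]
  · simp only [hp, if_false]; split_ifs <;> norm_num

lemma density_congr {p q : Ω → Prop} (h : ∀ x, p x ↔ q x) : density p = density q :=
  congrArg density (funext fun x => propext (h x))

lemma density_true [Nonempty Ω] : density (fun _ : Ω => True) = 1 := by
  simp [density]

lemma density_false : density (fun _ : Ω => False) = 0 := by
  simp [density]

lemma density_le_one (p : Ω → Prop) : density p ≤ 1 := by
  rcases isEmpty_or_nonempty Ω with h | h
  · simp [density]
  · rw [← density_true (Ω := Ω)]; exact density_mono fun _ _ => trivial

lemma density_or_le (p q : Ω → Prop) :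
    density (fun x => p x ∨ q x) ≤ density p + density q := by
  rw [density, density, density, ← expect_add_distrib]
  refine expect_le_expect fun x _ => ?_
  by_cases hp : p x <;> by_cases hq : q x <;> simp [hp, hq]

lemma density_le_add {p q r : Ω → Prop} (h : ∀ x, p x → q x ∨ r x) :
    density p ≤ density q + density r :=
  (density_mono h).trans (density_or_le q r)

lemma density_split (p q : Ω → Prop) :
    density p = density (fun x => p x ∧ q x) + density (fun x => p x ∧ ¬ q x) := by
  rw [density, density, density, ← expect_add_distrib]
  refine expect_congr rfl fun x _ => ?_
  by_cases hp : p x <;> by_cases hq : q x <;> simp [hp, hq]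

lemma density_not [Nonempty Ω] (p : Ω → Prop) : density (fun x => ¬ p x) = 1 - density p := by
  have := density_split (fun _ : Ω => True) p
  simp only [density_true, true_and] at this
  linarith

lemma density_or_add_and (p q : Ω → Prop) :
    density (fun x => p x ∨ q x) + density (fun x => p x ∧ q x) = density p + density q := by
  rw [density, density, density, density, ← expect_add_distrib, ← expect_add_distrib]
  refine expect_congr rfl fun x _ => ?_
  by_cases hp : p x <;> by_cases hq : q x <;> simp [hp, hq]

lemma density_equiv (e : Ω ≃ Ω') (p : Ω' → Prop) : density (fun x => p (e x)) = density p :=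
  Fintype.expect_equiv e _ _ fun _ => rfl

lemma exists_of_density_pos {p : Ω → Prop} (h : 0 < density p) : ∃ x, p x := by
  by_contra! hc
  rw [density_congr (q := fun _ => False) fun x => by simp [hc x], density_false] at h
  exact lt_irrefl _ h

lemma density_sum_le {ι : Type*} (s : Finset ι) {p : Ω → Prop} {q : ι → Ω → Prop}
    (h : ∀ x, p x → ∃ i ∈ s, q i x) : density p ≤ ∑ i ∈ s, density (q i) := by
  classical
  induction s using Finset.induction_on generalizing p with
  | empty =>
    rw [density_congr (q := fun _ => False) fun x => ⟨fun hx => by simpa using h x hx, False.elim⟩,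
      density_false, sum_empty]
  | insert i s hi ih =>
    rw [sum_insert hi]
    have h2 := ih (p := fun x => ∃ i ∈ s, q i x) fun x hx => hx
    have h1 := density_le_add (p := p) (q := q i) (r := fun x => ∃ i ∈ s, q i x)
      fun x hx => by simpa using h x hx
    linarith

/-- The pigeonhole principle for densities. -/
lemma exists_density_le_of_exists {ι : Type*} {s : Finset ι} {p : Ω → Prop} {q : ι → Ω → Prop}
    {c : ℝ} (hc : 0 < c) (hp : c ≤ density p) (h : ∀ x, p x → ∃ i ∈ s, q i x) :
    ∃ i ∈ s, c / #s ≤ density (q i) := by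
  have hs : s.Nonempty := by
    obtain ⟨x, hx⟩ := exists_of_density_pos (hc.trans_le hp)
    obtain ⟨i, hi, -⟩ := h x hx
    exact ⟨i, hi⟩
  by_contra! hcon
  have h1 := density_sum_le s h
  have h2 := sum_lt_sum_of_nonempty hs hcon
  have h3 : (0 : ℝ) < #s := by exact_mod_cast hs.card_pos
  rw [sum_const, nsmul_eq_mul, mul_div_cancel₀ _ h3.ne'] at h2
  linarith

/-- Fubini's theorem for densities. -/
lemma density_prod (p : A × B → Prop) : density p = 𝔼 a, density fun b => p (a, b) := by
  rw [density, ← univ_product_univ, expect_product]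
  rfl

lemma density_swap (p : A × B → Prop) : density p = density fun x : B × A => p (x.2, x.1) :=
  (density_equiv (Equiv.prodComm B A) p).symm

lemma density_prod' (p : A × B → Prop) : density p = 𝔼 b, density fun a => p (a, b) := by
  rw [density_swap, density_prod]

lemma density_fst [Nonempty B] (p : A → Prop) :
    density (fun x : A × B => p x.1) = density p := by
  rw [density_prod, density]
  refine expect_congr rfl fun x _ => ?_
  by_cases hp : p x <;> simp [hp, density_true, density_false]

lemma density_snd [Nonempty A] (p : B → Prop) :
    density (fun x : A × B => p x.2) = density p := by
  rw [density_swap, density_fst]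

lemma mul_density_le_density_prod {c : ℝ} {p : A → Prop} {q : A → B → Prop}
    (hq : ∀ a, p a → c ≤ density (q a)) :
    density p * c ≤ density fun x : A × B => p x.1 ∧ q x.1 x.2 := by
  rw [density_prod, density, expect_mul]
  refine expect_le_expect fun a _ => ?_
  by_cases hp : p a
  · simpa [hp] using hq a hp
  · simp [hp, density_false]

lemma density_prod_le {c : ℝ} {p : A → Prop} {q : A → B → Prop}
    (hq : ∀ a, p a → density (q a) ≤ c) :
    (density fun x : A × B => p x.1 ∧ q x.1 x.2) ≤ density p * c := by
  rw [density_prod, density, expect_mul]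
  refine expect_le_expect fun a _ => ?_
  by_cases hp : p a
  · simpa [hp] using hq a hp
  · simp [hp, density_false]

lemma density_and_prod (p : A → Prop) (q : B → Prop) :
    (density fun x : A × B => p x.1 ∧ q x.2) = density p * density q :=
  le_antisymm (density_prod_le fun _ _ => le_rfl) (mul_density_le_density_prod fun _ _ => le_rfl)

/-- Markov's inequality: a dense relation has many dense fibres. -/
lemma half_le_density_fiber {c : ℝ} {p : A × B → Prop} (hp : c ≤ density p) :
    c / 2 ≤ density fun a => c / 2 ≤ density fun b => p (a, b) := by
  rcases isEmpty_or_nonempty A with hA | hA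
  · have : density p ≤ 0 := by rw [density]; simp
    linarith [density_nonneg fun a => c / 2 ≤ density fun b => p (a, b)]
  rcases lt_or_ge c 0 with hc | hc
  · linarith [density_nonneg fun a => c / 2 ≤ density fun b => p (a, b)]
  have : density p ≤ (density fun a => c / 2 ≤ density fun b => p (a, b)) + c / 2 := by
    rw [density_prod]
    have h2 : c / 2 = 𝔼 _a : A, c / 2 := by simp
    conv_rhs => rw [h2, density, ← expect_add_distrib]
    refine expect_le_expect fun a _ => ?_
    simp only [expect_const univ_nonempty]
    split_ifs with h
    · linarith [density_le_one fun b => p (a, b)]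
    · linarith
  linarith

lemma exists_le_density_fiber {c : ℝ} (hc : 0 < c) {p : A × B → Prop} (hp : c ≤ density p) :
    ∃ a, c ≤ density fun b => p (a, b) := by
  by_contra! h
  rcases isEmpty_or_nonempty A with hA | hA
  · have : density p ≤ 0 := by rw [density]; simp
    linarith
  have : density p < c := by
    rw [density_prod]
    calc _ < 𝔼 _a : A, c := expect_lt_expect (fun a _ => (h a).le) ⟨hA.some, mem_univ _, h _⟩
      _ = c := by simp
  linarith

lemma density_pi {ι : Type*} [Fintype ι] [DecidableEq ι] (p : ι → A → Prop) :
    (density fun x : ι → A => ∀ i, p i (x i)) = ∏ i, density (p i) := by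
  classical
  simp only [density, Fintype.expect_eq_sum_div_card]
  rw [prod_div_distrib, Finset.prod_univ_sum, Fintype.piFinset_univ]
  congr 1
  · refine sum_congr rfl fun x _ => ?_
    rw [Finset.prod_ite_zero]
    simp
  · simp

lemma density_apply {ι : Type*} [Fintype ι] [DecidableEq ι] [Nonempty A] (i : ι) (p : A → Prop) :
    (density fun x : ι → A => p (x i)) = density p := by
  have := density_pi (A := A) (fun j a => j = i → p a)
  rw [density_congr (q := fun x : ι → A => p (x i)) fun x => by simp] at this
  rw [this, prod_eq_single i]
  · simp
  · intro j _ hj; simp [hj, density_true]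
  · simp

lemma density_apply_apply {ι κ : Type*} [Fintype ι] [Fintype κ] [DecidableEq ι] [DecidableEq κ]
    [Nonempty A] [Nonempty B] (i : ι) (j : κ) (p : A → B → Prop) :
    (density fun x : (ι → A) × (κ → B) => p (x.1 i) (x.2 j)) =
      density fun x : A × B => p x.1 x.2 := by
  have h1 : (density fun x : (ι → A) × (κ → B) => p (x.1 i) (x.2 j)) =
      density fun x : (ι → A) × B => p (x.1 i) x.2 := by
    rw [density_prod, density_prod]
    exact expect_congr rfl fun a _ => density_apply j (p (a i))
  rw [h1, density_prod', density_prod']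
  exact expect_congr rfl fun b _ => density_apply i fun a => p a b

/-- The blow-up lemma: if a proportion `c` of the pairs in `A × B` is related, then a proportion
`c ^ N` of the elements of `A ^ N × B` has each of the `N` entries related to the last one
(Jensen's inequality). -/
lemma pow_le_density_blowup {ι : Type*} [Fintype ι] [DecidableEq ι] [Nonempty B] {c : ℝ}
    (hc : 0 ≤ c) {p : A → B → Prop} (hp : c ≤ density fun x : A × B => p x.1 x.2) :
    c ^ Fintype.card ι ≤ density fun x : (ι → A) × B => ∀ i, p (x.1 i) x.2 := by
  rw [density_prod'] at hp ⊢
  simp only at hp ⊢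
  have h1 : ∀ b, (density fun x : ι → A => ∀ i, p (x i) b) =
      (density fun a => p a b) ^ Fintype.card ι := fun b => by
    rw [density_pi fun _ a => p a b, prod_const, card_univ]
  simp only [h1]
  refine (pow_le_pow_left₀ hc hp _).trans ?_
  generalize Fintype.card ι = n
  rcases n with _ | n
  · simp
  have h2 := pow_sum_div_card_le_sum_pow (s := (univ : Finset B))
    (f := fun b => density fun a => p a b) (fun _ _ => density_nonneg _) n
  have h3 : (0 : ℝ) < Fintype.card B := by exact_mod_cast Fintype.card_pos
  rw [Fintype.expect_eq_sum_div_card, Fintype.expect_eq_sum_div_card, div_pow,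
    div_le_div_iff₀ (by positivity) h3]
  rw [card_univ, div_le_iff₀ (by positivity)] at h2
  calc _ ≤ _ * (Fintype.card B : ℝ) := mul_le_mul_of_nonneg_right h2 h3.le
    _ = _ := by ring

end Density

/-! ### Exchangeable multisets -/

section Exchange

variable {V : Type*}

/-- The multiset of the entries of a tuple. -/
def tup {ι : Type*} [Fintype ι] (s : ι → V) : Multiset V := ∑ i, {s i}

lemma card_tup {ι : Type*} [Fintype ι] (s : ι → V) : (tup s).card = Fintype.card ι := by
  simp [tup]

lemma mem_tup {ι : Type*} [Fintype ι] {s : ι → V} {v : V} : v ∈ tup s ↔ ∃ i, s i = v := by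
  simp [tup, Multiset.mem_sum, eq_comm]

variable [Fintype V]

/-- `f` draws a multiset of size `k` with the distribution of `k` independent uniform vertices. -/
def Samples {Ω : Type*} [Fintype Ω] (f : Ω → Multiset V) (k : ℕ) : Prop :=
  ∀ p : Multiset V → Prop, (density fun x => p (f x)) = density fun s : Fin k → V => p (tup s)

lemma samples_tup {ι : Type*} [Fintype ι] [DecidableEq ι] :
    Samples (fun s : ι → V => tup s) (Fintype.card ι) := fun p => by
  rw [← density_equiv ((Fintype.equivFin ι).symm.arrowCongr (Equiv.refl V))]
  refine density_congr fun s => ?_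
  have : tup ((Fintype.equivFin ι).symm.arrowCongr (Equiv.refl V) s) = tup s :=
    Fintype.sum_equiv (Fintype.equivFin ι) _ _ fun i => by simp [Equiv.arrowCongr]
  simp only [this]

lemma samples_fin (k : ℕ) : Samples (fun s : Fin k → V => tup s) k := fun _ => rfl

lemma Samples.cast {Ω : Type*} [Fintype Ω] {f : Ω → Multiset V} {k l : ℕ} (hf : Samples f k)
    (h : k = l) : Samples f l := h ▸ hf

lemma samples_singleton : Samples (fun v : V => {v}) 1 := fun p => by
  rw [← density_equiv (Equiv.funUnique (Fin 1) V)]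
  exact density_congr fun s => by simp [tup]

lemma Samples.prod {Ω Ω' : Type*} [Fintype Ω] [Fintype Ω'] {f : Ω → Multiset V}
    {g : Ω' → Multiset V} {k l : ℕ} (hf : Samples f k) (hg : Samples g l) :
    Samples (fun x : Ω × Ω' => f x.1 + g x.2) (k + l) := fun p => by
  have h1 : (density fun x : Ω × Ω' => p (f x.1 + g x.2)) =
      density fun x : (Fin k → V) × (Fin l → V) => p (tup x.1 + tup x.2) := by
    calc _ = density fun x : Ω × (Fin l → V) => p (f x.1 + tup x.2) := by
          rw [density_prod, density_prod]
          exact expect_congr rfl fun a _ => hg fun M => p (f a + M)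
      _ = _ := by
          rw [density_prod', density_prod']
          exact expect_congr rfl fun b _ => hf fun M => p (M + tup b)
  rw [h1]
  have h2 := samples_tup (V := V) (ι := Fin k ⊕ Fin l) p
  rw [Fintype.card_sum, Fintype.card_fin, Fintype.card_fin] at h2
  rw [← h2, ← density_equiv (Equiv.sumArrowEquivProdArrow (Fin k) (Fin l) V)]
  refine density_congr fun s => ?_
  simp [tup, Fintype.sum_sum_type, Equiv.sumArrowEquivProdArrow]

/-- `Exch C c K P Q` says that `P` and `Q` are exchangeable with respect to `C`: for some `k ≤ K`,
a proportion at least `c` of the `k`-tuples completes both `P` and `Q` to elements of `C`. -/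
def Exch (C : AddSubmonoid (Multiset V)) (c : ℝ) (K : ℕ) (P Q : Multiset V) : Prop :=
  ∃ k ≤ K, c ≤ density fun s : Fin k → V => P + tup s ∈ C ∧ Q + tup s ∈ C

variable {C : AddSubmonoid (Multiset V)} {c c' : ℝ} {K K' : ℕ} {P Q R P' Q' : Multiset V}

lemma Exch.symm (h : Exch C c K P Q) : Exch C c K Q P := by
  obtain ⟨k, hk, h⟩ := h
  exact ⟨k, hk, h.trans (density_mono fun _ hx => hx.symm)⟩

lemma Exch.mono (h : Exch C c K P Q) (hc : c' ≤ c) (hK : K ≤ K') : Exch C c' K' P Q := by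
  obtain ⟨k, hk, h⟩ := h
  exact ⟨k, hk.trans hK, hc.trans h⟩

lemma exch_of_samples {Ω : Type*} [Fintype Ω] {f : Ω → Multiset V} {k : ℕ} (hf : Samples f k)
    (hk : k ≤ K) (h : c ≤ density fun x => P + f x ∈ C ∧ Q + f x ∈ C) : Exch C c K P Q :=
  ⟨k, hk, h.trans_eq (hf fun M => P + M ∈ C ∧ Q + M ∈ C)⟩

lemma exch_zero : Exch C 1 0 0 0 :=
  ⟨0, le_rfl, by simp [tup, density_true, C.zero_mem]⟩

lemma Exch.add (hc' : 0 ≤ c') (h : Exch C c K P Q) (h' : Exch C c' K' P' Q') :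
    Exch C (c * c') (K + K') (P + P') (Q + Q') := by
  obtain ⟨k, hk, h⟩ := h
  obtain ⟨l, hl, h'⟩ := h'
  refine exch_of_samples ((samples_fin k).prod (samples_fin l)) (add_le_add hk hl) ?_
  refine (mul_le_mul h h' hc' (density_nonneg _)).trans ?_
  rw [← density_and_prod]
  refine density_mono fun x hx => ⟨?_, ?_⟩
  · rw [add_add_add_comm]; exact C.add_mem hx.1.1 hx.2.1
  · rw [add_add_add_comm]; exact C.add_mem hx.1.2 hx.2.2

lemma exch_tup {ι : Type*} [Fintype ι] (hc : 0 ≤ c) {s t : ι → V}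
    (h : ∀ i, Exch C c K {s i} {t i}) :
    Exch C (c ^ Fintype.card ι) (Fintype.card ι * K) (tup s) (tup t) := by
  classical
  have key : ∀ I : Finset ι, Exch C (c ^ #I) (#I * K) (∑ i ∈ I, {s i}) (∑ i ∈ I, {t i}) := by
    intro I
    induction I using Finset.induction_on with
    | empty => simpa using exch_zero
    | insert i I hi ih =>
      rw [sum_insert hi, sum_insert hi, card_insert_of_notMem hi]
      refine ((h i).add (pow_nonneg hc _) ih).mono (by rw [pow_succ']) ?_
      rw [Nat.succ_mul, add_comm]
  exact key univ

/-- If a random multiset `f x` has, with probability at least `η`, many extensions that complete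
both `P` and `Q`, then `P` and `Q` are exchangeable. -/
lemma exch_of_dense {Ω : Type*} [Fintype Ω] {f : Ω → Multiset V} {l : ℕ} (hf : Samples f l)
    {η : ℝ} (hη : 0 < η) (hc : 0 ≤ c) {r : Ω → Prop} (hr : η ≤ density r)
    (h : ∀ x, r x → ∃ k ≤ K, c ≤ density fun s : Fin k → V =>
      P + (f x + tup s) ∈ C ∧ Q + (f x + tup s) ∈ C) :
    Exch C (η / (K + 1) * c) (l + K) P Q := by
  obtain ⟨k, hk, hd⟩ := exists_density_le_of_exists (s := range (K + 1)) (q := fun k x =>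
    c ≤ density fun s : Fin k → V => P + (f x + tup s) ∈ C ∧ Q + (f x + tup s) ∈ C) hη hr
    fun x hx => by
      obtain ⟨k, hk, h⟩ := h x hx
      exact ⟨k, mem_range.2 (Nat.lt_succ_of_le hk), h⟩
  refine exch_of_samples (hf.prod (samples_fin k))
    (by simpa using Nat.lt_succ_iff.1 (mem_range.1 hk)) ?_
  rw [card_range, Nat.cast_add, Nat.cast_one] at hd
  refine (mul_le_mul_of_nonneg_right hd hc).trans ?_
  refine (mul_density_le_density_prod fun x hx => hx).trans (density_mono fun x hx => hx.2)

lemma exch_trans {Ω : Type*} [Fintype Ω] {f : Ω → Multiset V} {l : ℕ} (hf : Samples f l)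
    {η : ℝ} (hη : 0 < η) (hc : 0 ≤ c) (hc' : 0 ≤ c')
    (h : η ≤ density fun x => Exch C c K P (f x) ∧ Exch C c' K' (f x) Q) :
    Exch C (η / ((K + K' : ℕ) + 1) * (c * c')) (l + (K + K')) P Q := by
  refine exch_of_dense hf hη (mul_nonneg hc hc') h ?_
  rintro x ⟨⟨k, hk, h1⟩, ⟨k', hk', h2⟩⟩
  refine ⟨k + k', add_le_add hk hk', ?_⟩
  have h3 := (samples_fin (V := V) k).prod (samples_fin k')
    fun M => P + (f x + M) ∈ C ∧ Q + (f x + M) ∈ C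
  rw [← h3]
  refine (mul_le_mul h1 h2 hc' (density_nonneg _)).trans ?_
  rw [← density_and_prod]
  refine density_mono fun y hy => ⟨?_, ?_⟩
  · rw [show P + (f x + (tup y.1 + tup y.2)) = P + tup y.1 + (f x + tup y.2) by abel]
    exact C.add_mem hy.1.1 hy.2.1
  · rw [show Q + (f x + (tup y.1 + tup y.2)) = f x + tup y.1 + (Q + tup y.2) by abel]
    exact C.add_mem hy.1.2 hy.2.2

/-- If many pairs of tuples `s`, `t` are such that `s` completes `P` and `t` completes `Q` to an
element of `C` and each entry of `s` is exchangeable with the corresponding entry of `t`, then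
`P` and `Q` are exchangeable. -/
lemma exch_of_paired {ι : Type*} [Fintype ι] [DecidableEq ι] {η : ℝ} (hη : 0 < η) (hc : 0 ≤ c)
    (h : η ≤ density fun x : (ι → V) × (ι → V) =>
      P + tup x.1 ∈ C ∧ Q + tup x.2 ∈ C ∧ ∀ i, Exch C c K {x.1 i} {x.2 i}) :
    Exch C (η / ((Fintype.card ι * K : ℕ) + 1) * c ^ Fintype.card ι)
      (Fintype.card ι + Fintype.card ι + Fintype.card ι * K) P Q := by
  refine exch_of_dense ((samples_tup (ι := ι)).prod samples_tup) hη (pow_nonneg hc _) h ?_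
  rintro x ⟨hP, hQ, hx⟩
  obtain ⟨k, hk, h⟩ := exch_tup hc hx
  refine ⟨k, hk, h.trans (density_mono fun y hy => ⟨?_, ?_⟩)⟩
  · rw [show P + (tup x.1 + tup x.2 + tup y) = P + tup x.1 + (tup x.2 + tup y) by abel]
    exact C.add_mem hP hy.2
  · rw [show Q + (tup x.1 + tup x.2 + tup y) = Q + tup x.2 + (tup x.1 + tup y) by abel]
    exact C.add_mem hQ hy.1

end Exchange

/-! ### Blow-ups and blocks -/

section Blowup

variable {A B D : Type*} [Fintype A] [Fintype B] [Fintype D]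

lemma density_rotate (p : A × B × D → Prop) :
    density p = density fun x : B × D × A => p (x.2.2, x.1, x.2.1) := by
  rw [← density_equiv (Equiv.prodAssoc B D A), density_swap]
  rfl

lemma pow_le_density_blowup₃ {ι κ ν : Type*} [Fintype ι] [Fintype κ] [Fintype ν] [DecidableEq ι]
    [DecidableEq κ] [DecidableEq ν] [Nonempty A] [Nonempty B] [Nonempty D] {θ : ℝ} (hθ : 0 ≤ θ)
    {p : A → B → D → Prop} (h : θ ≤ density fun x : A × B × D => p x.1 x.2.1 x.2.2) :
    θ ^ (Fintype.card ι * Fintype.card κ * Fintype.card ν) ≤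
      density fun x : (ι → A) × (κ → B) × (ν → D) => ∀ i j k, p (x.1 i) (x.2.1 j) (x.2.2 k) := by
  have h1 := pow_le_density_blowup (ι := ι) hθ (p := fun a (y : B × D) => p a y.1 y.2) h
  rw [density_rotate] at h1
  have h2 := pow_le_density_blowup (ι := κ) (pow_nonneg hθ _)
    (p := fun b (y : D × (ι → A)) => ∀ i, p (y.2 i) b y.1) h1
  rw [density_rotate] at h2
  have h3 := pow_le_density_blowup (ι := ν) (pow_nonneg (pow_nonneg hθ _) _)
    (p := fun d (y : (ι → A) × (κ → B)) => ∀ j i, p (y.1 i) (y.2 j) d) h2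
  rw [density_rotate] at h3
  rw [pow_mul, pow_mul]
  exact h3.trans (density_mono fun x hx i j k => hx k j i)

end Blowup

section Blocks

variable {V : Type*}

/-- A ternary relation that is invariant under permutations of its arguments. -/
structure IsSymmetric (E : V → V → V → Prop) : Prop where
  swap_left : ∀ {x y z}, E x y z → E y x z
  swap_right : ∀ {x y z}, E x y z → E x z y

/-- The multisets `X + Y + Z` with parts of sizes `a`, `b`, `c` such that all transversal triples
are related. No element is required to have multiplicity one: a block without repeated elements is
the vertex set of a copy of the complete tripartite `3`-graph. -/
def IsBlock (E : V → V → V → Prop) (a b c : ℕ) (M : Multiset V) : Prop :=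
  ∃ X Y Z : Multiset V, X.card = a ∧ Y.card = b ∧ Z.card = c ∧ M = X + Y + Z ∧
    ∀ x ∈ X, ∀ y ∈ Y, ∀ z ∈ Z, E x y z

/-- The sums of blocks. Such a sum without repeated elements is a set with a factor. -/
def tileable (E : V → V → V → Prop) (a b c : ℕ) : AddSubmonoid (Multiset V) :=
  AddSubmonoid.closure {M | IsBlock E a b c M}

variable {E : V → V → V → Prop} {a b c : ℕ}

lemma IsBlock.mem_tileable {M : Multiset V} (h : IsBlock E a b c M) : M ∈ tileable E a b c :=
  AddSubmonoid.subset_closure h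

lemma IsBlock.card_eq {M : Multiset V} (h : IsBlock E a b c M) : M.card = a + b + c := by
  obtain ⟨X, Y, Z, rfl, rfl, rfl, rfl, -⟩ := h
  simp

lemma dvd_card_of_mem_tileable {M : Multiset V} (h : M ∈ tileable E a b c) :
    a + b + c ∣ M.card := by
  induction h using AddSubmonoid.closure_induction with
  | mem M hM => exact (IsBlock.card_eq hM).symm.dvd
  | zero => simp
  | add M N _ _ hM hN => rw [Multiset.card_add]; exact dvd_add hM hN

lemma isBlock_singleton_add {v : V} {x : (Fin a → V) × (Fin b → V) × (Fin c → V)}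
    (h₁ : ∀ j k, E v (x.2.1 j) (x.2.2 k)) (h₂ : ∀ i j k, E (x.1 i) (x.2.1 j) (x.2.2 k)) :
    IsBlock E (a + 1) b c ({v} + (tup x.1 + (tup x.2.1 + tup x.2.2))) := by
  refine ⟨{v} + tup x.1, tup x.2.1, tup x.2.2, by simp [card_tup, add_comm], by simp [card_tup],
    by simp [card_tup], by abel, ?_⟩
  intro w hw y hy z hz
  obtain ⟨j, rfl⟩ := mem_tup.1 hy
  obtain ⟨k, rfl⟩ := mem_tup.1 hz
  rcases Multiset.mem_add.1 hw with hw | hw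
  · rw [Multiset.mem_singleton.1 hw]; exact h₁ j k
  · obtain ⟨i, rfl⟩ := mem_tup.1 hw; exact h₂ i j k

variable [Fintype V]

/-- The proportion of the vertices that form an edge with the pair `x`, `y`. -/
noncomputable def codensity (E : V → V → V → Prop) (x y : V) : ℝ := density fun w => E w x y

lemma codensity_comm (hE : IsSymmetric E) (x y : V) : codensity E x y = codensity E y x :=
  density_congr fun _ => ⟨hE.swap_right, hE.swap_right⟩

/-- A vertex is `ζ`-exceptional if many of its edges contain a pair of small codegree. -/
def Exceptional (E : V → V → V → Prop) (ζ : ℝ) (v : V) : Prop :=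
  ζ < density fun x : V × V => E v x.1 x.2 ∧ (codensity E x.1 x.2 < ζ ^ 2 ∨
    codensity E v x.1 < ζ ^ 2 ∨ codensity E v x.2 < ζ ^ 2)

lemma density_edge_codensity_lt (ε : ℝ) (hε : 0 ≤ ε) :
    (density fun x : V × V × V => E x.1 x.2.1 x.2.2 ∧ codensity E x.2.1 x.2.2 < ε) ≤ ε := by
  rw [density_swap]
  calc _ ≤ density (fun x : (V × V) × V => codensity E x.1.1 x.1.2 < ε ∧ E x.2 x.1.1 x.1.2) :=
        density_mono fun _ h => h.symm
    _ ≤ density (fun x : V × V => codensity E x.1 x.2 < ε) * ε :=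
        density_prod_le (p := fun x : V × V => codensity E x.1 x.2 < ε)
          (q := fun x w => E w x.1 x.2) fun x hx => hx.le
    _ ≤ 1 * ε := mul_le_mul_of_nonneg_right (density_le_one _) hε
    _ = ε := one_mul ε

lemma density_exceptional_le (hE : IsSymmetric E) {ζ : ℝ} (hζ : 0 < ζ) :
    density (Exceptional E ζ) ≤ 3 * ζ := by
  have h0 := density_edge_codensity_lt (E := E) (ζ ^ 2) (by positivity)
  have h1 : (density fun x : V × V × V => E x.1 x.2.1 x.2.2 ∧ codensity E x.1 x.2.1 < ζ ^ 2) ≤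
      ζ ^ 2 := by
    rw [density_rotate, density_rotate]
    exact (density_mono fun x hx => ⟨hE.swap_left (hE.swap_right hx.1), hx.2⟩).trans h0
  have h2 : (density fun x : V × V × V => E x.1 x.2.1 x.2.2 ∧ codensity E x.1 x.2.2 < ζ ^ 2) ≤
      ζ ^ 2 := by
    rw [density_rotate]
    exact (density_mono fun x hx => ⟨hE.swap_right (hE.swap_left hx.1),
      (codensity_comm hE _ _).trans_lt hx.2⟩).trans h0
  have h3 : density (Exceptional E ζ) * ζ ≤ _ := mul_density_le_density_prod
    (p := Exceptional E ζ) (q := fun v (x : V × V) => E v x.1 x.2 ∧ (codensity E x.1 x.2 < ζ ^ 2 ∨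
    codensity E v x.1 < ζ ^ 2 ∨ codensity E v x.2 < ζ ^ 2)) fun v hv => le_of_lt hv
  have h4 := h3.trans (density_le_add (q := fun x : V × V × V => E x.1 x.2.1 x.2.2 ∧
    codensity E x.2.1 x.2.2 < ζ ^ 2) (r := fun x => E x.1 x.2.1 x.2.2 ∧
    (codensity E x.1 x.2.1 < ζ ^ 2 ∨ codensity E x.1 x.2.2 < ζ ^ 2)) fun x hx => by tauto)
  have h5 := density_le_add (p := fun x : V × V × V => E x.1 x.2.1 x.2.2 ∧
    (codensity E x.1 x.2.1 < ζ ^ 2 ∨ codensity E x.1 x.2.2 < ζ ^ 2))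
    (q := fun x => E x.1 x.2.1 x.2.2 ∧ codensity E x.1 x.2.1 < ζ ^ 2)
    (r := fun x => E x.1 x.2.1 x.2.2 ∧ codensity E x.1 x.2.2 < ζ ^ 2) fun x hx => by tauto
  refine le_of_mul_le_mul_right ?_ hζ
  nlinarith

/-- If many triples `w`, `x`, `y` have `q x y` and, unless `a = 0`, form an edge, then many
triples of tuples of lengths `a`, `b`, `c` have all their transversal triples of this kind.
For `a = 0` the relation `q` alone is blown up. -/
lemma density_join {q : V → V → Prop} {θ : ℝ} (hθ : 0 < θ) (a b c : ℕ)
    (h : θ ≤ density fun x : V × V × V => q x.2.1 x.2.2 ∧ (a = 0 ∨ E x.1 x.2.1 x.2.2)) :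
    θ ^ ((a + 1) * b * c) ≤ density fun x : (Fin a → V) × (Fin b → V) × (Fin c → V) =>
      (∀ j k, q (x.2.1 j) (x.2.2 k)) ∧ ∀ i j k, E (x.1 i) (x.2.1 j) (x.2.2 k) := by
  obtain ⟨x, -⟩ := exists_of_density_pos (hθ.trans_le h)
  have : Nonempty V := ⟨x.1⟩
  have h1 := pow_le_density_blowup₃ (ι := Fin (a + 1)) (κ := Fin b) (ν := Fin c) hθ.le
    (p := fun w x y => q x y ∧ (a = 0 ∨ E w x y)) h
  rw [← density_equiv ((Fin.consEquiv fun _ : Fin (a + 1) => V).prodCongr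
    (Equiv.refl ((Fin b → V) × (Fin c → V)))), ← density_equiv (Equiv.prodAssoc _ _ _).symm] at h1
  simp only [Fintype.card_fin] at h1
  obtain ⟨v, hv⟩ := exists_le_density_fiber (pow_pos hθ _) h1
  refine hv.trans (density_mono fun x hx => ⟨fun j k => (hx 0 j k).1, fun i j k => ?_⟩)
  have h2 := (hx i.succ j k).2
  simp only [Equiv.prodCongr_apply, Equiv.prodAssoc_symm_apply, Prod.map, Fin.consEquiv,
    Equiv.coe_fn_mk, Fin.cons_succ, Equiv.refl_apply] at h2
  rcases h2 with h2 | h2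
  · subst h2; exact i.elim0
  · exact h2

lemma samples_parts (a b c : ℕ) : Samples (fun x : (Fin a → V) × (Fin b → V) × (Fin c → V) =>
    tup x.1 + (tup x.2.1 + tup x.2.2)) (a + (b + c)) :=
  (samples_fin a).prod ((samples_fin b).prod (samples_fin c))

/-- A vertex whose link contains many pairs of large codegree is in many blocks; for blocks with a
part of size one no condition on the codegrees is needed. -/
lemma density_block_at {θ : ℝ} (hθ : 0 < θ) {v : V}
    (h : θ ≤ density fun x : V × V × V => E v x.2.1 x.2.2 ∧ (a = 0 ∨ E x.1 x.2.1 x.2.2)) :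
    θ ^ ((a + 1) * b * c) ≤
      density fun s : Fin (a + (b + c)) → V => {v} + tup s ∈ tileable E (a + 1) b c := by
  rw [← samples_parts a b c fun M => {v} + M ∈ tileable E (a + 1) b c]
  exact (density_join hθ a b c h).trans
    (density_mono fun x hx => (isBlock_singleton_add hx.1 hx.2).mem_tileable)

lemma exch_of_common_link {θ : ℝ} (hθ : 0 < θ) {u v : V}
    (h : θ ≤ density fun x : V × V × V => (E u x.2.1 x.2.2 ∧ E v x.2.1 x.2.2) ∧
      E x.1 x.2.1 x.2.2) :
    Exch (tileable E (a + 1) b c) (θ ^ ((a + 1) * b * c)) (a + (b + c)) {u} {v} := by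
  refine exch_of_samples (samples_parts a b c) le_rfl ?_
  refine (density_join (q := fun x y => E u x y ∧ E v x y) hθ a b c (h.trans (density_mono
    fun x hx => ⟨hx.1, Or.inr hx.2⟩))).trans (density_mono fun x hx => ⟨?_, ?_⟩)
  · exact (isBlock_singleton_add (fun j k => (hx.1 j k).1) hx.2).mem_tileable
  · exact (isBlock_singleton_add (fun j k => (hx.1 j k).2) hx.2).mem_tileable

/-- A vertex that is not exceptional is exchangeable with any vertex sharing much of its link. -/
lemma exch_of_not_exceptional {ζ : ℝ} (hζ : 0 < ζ) {u v : V} (hu : ¬ Exceptional E ζ u)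
    (h : 2 * ζ ≤ density fun x : V × V => E u x.1 x.2 ∧ E v x.1 x.2) :
    Exch (tileable E (a + 1) b c) ((ζ * ζ ^ 2) ^ ((a + 1) * b * c)) (a + (b + c)) {u} {v} := by
  refine exch_of_common_link (by positivity) ?_
  have h1 : ζ ≤ density fun x : V × V => (E u x.1 x.2 ∧ E v x.1 x.2) ∧
      ¬ codensity E x.1 x.2 < ζ ^ 2 := by
    have h2 := density_split (fun x : V × V => E u x.1 x.2 ∧ E v x.1 x.2)
      fun x => codensity E x.1 x.2 < ζ ^ 2
    have h3 := (density_mono (p := fun x : V × V => (E u x.1 x.2 ∧ E v x.1 x.2) ∧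
      codensity E x.1 x.2 < ζ ^ 2) fun x hx => ⟨hx.1.1, Or.inl hx.2⟩).trans (not_lt.1 hu)
    linarith
  rw [density_swap]
  refine (mul_le_mul_of_nonneg_right h1 (sq_nonneg ζ)).trans ?_
  refine (mul_density_le_density_prod (q := fun x w => E w x.1 x.2)
    fun x hx => not_lt.1 hx.2).trans (density_mono fun x hx => ⟨hx.1.1, hx.2⟩)

end Blocks

/-! ### Shadows and blocks through a vertex -/

section Shadow

variable {V : Type*} [Fintype V]

/-- The bound of Füredi and Zhao on the size of the shadow of a `3`-graph, at the density `6 - 4 *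
√2`: if almost every vertex of a graph is in a proportion `6 - 4 * √2` of ordered triangles, then
the graph has edge density almost `1 - (6 - 4 * √2)`. -/
lemma le_density_of_triangles [Nonempty V] {G : V → V → Prop} (hG : ∀ x y, G x y → G y x)
    {X : V → Prop} {ε : ℝ} (hX : density X ≤ ε) (hε : ε < 1)
    (h : ∀ v, ¬ X v → 6 - 4 * √2 ≤ density fun x : V × V => G v x.1 ∧ G v x.2 ∧ G x.1 x.2) :
    1 - (6 - 4 * √2) - 2 * ε ≤ density fun x : V × V => G x.1 x.2 := by
  classical
  have hs : √2 ^ 2 = 2 := Real.sq_sqrt (by norm_num)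
  have hs1 : (1.414 : ℝ) ≤ √2 := Real.le_sqrt_of_sq_le (by norm_num)
  have hs2 : √2 ≤ 1.4143 := Real.sqrt_le_iff.2 (by norm_num)
  have hnX := density_not X
  have hε0 : 0 ≤ ε := (density_nonneg X).trans hX
  -- a vertex of minimum degree among the vertices outside `X`
  obtain ⟨v, hv, hmin⟩ : ∃ v, ¬ X v ∧ ∀ w, ¬ X w → density (G v) ≤ density (G w) := by
    obtain ⟨w, hw⟩ := exists_of_density_pos (p := fun x => ¬ X x) (by linarith)
    obtain ⟨v, hv, hmin⟩ := exists_min_image (univ.filter fun x => ¬ X x)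
      (fun x => density (G x)) ⟨w, by simpa using hw⟩
    exact ⟨v, by simpa using hv, fun w hw => hmin w (by simpa using hw)⟩
  set ρ := density (G v)
  have hρ1 : ρ ≤ 1 := density_le_one _
  have hρ0 : 0 ≤ ρ := density_nonneg _
  have hρ : 2 - √2 ≤ ρ := by
    have h1 := (h v hv).trans (density_mono (q := fun x : V × V => G v x.1 ∧ G v x.2)
      fun x hx => ⟨hx.1, hx.2.1⟩)
    rw [density_and_prod] at h1
    change _ ≤ ρ * ρ at h1
    nlinarith
  rcases le_or_gt (1 - (6 - 4 * √2)) ρ with hρd | hρd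
  · have h1 := (mul_density_le_density_prod (p := fun x => ¬ X x) (q := G) hmin).trans
      (density_mono (q := fun x : V × V => G x.1 x.2) fun x hx => hx.2)
    rw [hnX] at h1
    nlinarith
  -- count the edges inside and outside of the neighbourhood of `v`
  have h1 := density_split (fun x : V × V => G x.1 x.2) fun x => G v x.1 ∧ G v x.2
  have h2 := (h v hv).trans (density_mono (q := fun x : V × V => G x.1 x.2 ∧ G v x.1 ∧ G v x.2)
    fun x hx => ⟨hx.2.2, hx.1, hx.2.1⟩)
  have h3 := density_split (fun x : V × V => G x.1 x.2 ∧ ¬ (G v x.1 ∧ G v x.2)) fun x => G v x.1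
  have h4 : density (fun x => ¬ G v x ∧ ¬ X x) * ρ ≤ density fun x : V × V =>
      (G x.1 x.2 ∧ ¬ (G v x.1 ∧ G v x.2)) ∧ ¬ G v x.1 :=
    (mul_density_le_density_prod (p := fun x => ¬ G v x ∧ ¬ X x) (q := G)
      fun x hx => hmin x hx.2).trans
        (density_mono fun x hx => ⟨⟨hx.2, fun h => hx.1.1 h.1⟩, hx.1.1⟩)
  have h5 : density (fun x => ¬ G v x ∧ ¬ X x) * (2 * ρ - 1) ≤ density fun x : V × V =>
      (G x.1 x.2 ∧ ¬ (G v x.1 ∧ G v x.2)) ∧ G v x.1 := by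
    rw [density_swap]
    refine (mul_density_le_density_prod (p := fun x => ¬ G v x ∧ ¬ X x)
      (q := fun x y => G x y ∧ G v y) fun x hx => ?_).trans (density_mono fun x hx =>
        ⟨⟨hG _ _ hx.2.1, fun h => hx.1.1 h.2⟩, hx.2.2⟩)
    have h6 := density_split (G x) (G v)
    have h7 := density_mono (p := fun y => G x y ∧ ¬ G v y) (q := fun y => ¬ G v y)
      fun y hy => hy.2
    have h8 := density_not (G v)
    have h9 := hmin x hx.2
    change _ = 1 - ρ at h8
    linarith
  have h6 : 1 - ρ - ε ≤ density fun x => ¬ G v x ∧ ¬ X x := by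
    have h7 := density_split (fun x => ¬ G v x) X
    have h8 := density_mono (p := fun x => ¬ G v x ∧ X x) (q := X) fun y hy => hy.2
    have h9 := density_not (G v)
    change _ = 1 - ρ at h9
    linarith
  have h7 : (1 - ρ - ε) * (3 * ρ - 1) ≤ density (fun x => ¬ G v x ∧ ¬ X x) * (3 * ρ - 1) :=
    mul_le_mul_of_nonneg_right h6 (by linarith)
  -- the concave function `(1 - ρ) * (3 * ρ - 1)` is at least its value at `2 - √2`
  have h8 : (√2 - 1) * (5 - 3 * √2) ≤ (1 - ρ) * (3 * ρ - 1) := by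
    nlinarith [mul_nonneg (sub_nonneg.2 hρ) (show 0 ≤ 4 - 3 * ρ - 3 * (2 - √2) by linarith)]
  nlinarith

variable {E : V → V → V → Prop} {a b c : ℕ}

lemma density_block_at_of_sqrt_two [Nonempty V] (hE : IsSymmetric E) {γ : ℝ} (hγ : 0 < γ)
    (hδ : ∀ v, 6 - 4 * √2 + γ ≤ density fun x : V × V => E v x.1 x.2) (v : V) :
    (γ / 2 * (γ / 12) ^ 2) ^ ((a + 1) * b * c) ≤
      density fun s : Fin (a + (b + c)) → V => {v} + tup s ∈ tileable E (a + 1) b c := by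
  have hs : √2 ≤ 1.4143 := Real.sqrt_le_iff.2 (by norm_num)
  have hγ1 := (hδ v).trans (density_le_one _)
  have hζ : 0 < γ / 12 := by positivity
  have hG := le_density_of_triangles (V := V) (G := fun x y => (γ / 12) ^ 2 ≤ codensity E x y)
    (fun x y h => h.trans_eq (codensity_comm hE x y)) (density_exceptional_le hE hζ) (by linarith)
    fun v hv => by
      have h1 := density_le_add (p := fun x : V × V => E v x.1 x.2) (q := fun x => E v x.1 x.2 ∧
        (codensity E x.1 x.2 < (γ / 12) ^ 2 ∨ codensity E v x.1 < (γ / 12) ^ 2 ∨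
          codensity E v x.2 < (γ / 12) ^ 2)) (r := fun x => (γ / 12) ^ 2 ≤ codensity E v x.1 ∧
          (γ / 12) ^ 2 ≤ codensity E v x.2 ∧ (γ / 12) ^ 2 ≤ codensity E x.1 x.2) fun x hx => by
            simp only [← not_lt]; tauto
      have h2 := not_lt.1 hv
      linarith [hδ v]
  refine density_block_at (by positivity) ?_
  have h1 := density_or_add_and (fun x : V × V => E v x.1 x.2)
    fun x => (γ / 12) ^ 2 ≤ codensity E x.1 x.2
  have h2 := density_le_one fun x : V × V => E v x.1 x.2 ∨ (γ / 12) ^ 2 ≤ codensity E x.1 x.2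
  have h3 : γ / 2 ≤ density fun x : V × V => E v x.1 x.2 ∧ (γ / 12) ^ 2 ≤ codensity E x.1 x.2 := by
    linarith [hδ v]
  rw [density_swap]
  refine (mul_le_mul_of_nonneg_right h3 (sq_nonneg _)).trans ?_
  exact (mul_density_le_density_prod (q := fun x w => E w x.1 x.2) fun x hx => hx.2).trans
    (density_mono fun x hx => ⟨hx.1.1, Or.inr hx.2⟩)

lemma density_block_at_of_one {δ : ℝ} (hδ : 0 < δ) {v : V}
    (h : δ ≤ density fun x : V × V => E v x.1 x.2) :
    δ ^ (b * c) ≤ density fun s : Fin (0 + (b + c)) → V => {v} + tup s ∈ tileable E 1 b c := by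
  have : Nonempty V := ⟨v⟩
  have := density_block_at (E := E) (a := 0) (b := b) (c := c) (v := v) hδ (by
    simpa using h.trans_eq (density_snd (A := V) fun x : V × V => E v x.1 x.2).symm)
  simpa using this

end Shadow

/-! ### Crossing a cut in the coprime case -/

section CoprimeCut

lemma exists_add_of_card_eq_add {V : Type*} {X : Multiset V} {m n : ℕ} (h : X.card = m + n) :
    ∃ X₁ X₂ : Multiset V, X = X₁ + X₂ ∧ X₁.card = m ∧ X₂.card = n := by
  induction X using Quotient.inductionOn with
  | h l =>
    refine ⟨l.take m, l.drop m, by simp, ?_, ?_⟩ <;> simp at h ⊢ <;> omega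

/-- The triples `(p, q, r)` that are sums of rearrangements of `(a, b, c)` of the four kinds that
have `a` or `c` in the last place. -/
def partSizes (a b c : ℕ) : AddSubmonoid (ℕ × ℕ × ℕ) :=
  AddSubmonoid.closure {(a, b, c), (b, a, c), (b, c, a), (c, b, a)}

lemma mem_tileable_of_mem_partSizes {V : Type*} {E : V → V → V → Prop} (hE : IsSymmetric E)
    {a b c : ℕ} {t : ℕ × ℕ × ℕ} (ht : t ∈ partSizes a b c) :
    ∀ X Y Z : Multiset V, X.card = t.1 → Y.card = t.2.1 → Z.card = t.2.2 →
      (∀ x ∈ X, ∀ y ∈ Y, ∀ z ∈ Z, E x y z) → X + Y + Z ∈ tileable E a b c := by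
  induction ht using AddSubmonoid.closure_induction with
  | mem t ht =>
    intro X Y Z hX hY hZ h
    apply IsBlock.mem_tileable
    rcases ht with rfl | rfl | rfl | rfl
    · exact ⟨X, Y, Z, hX, hY, hZ, rfl, h⟩
    · exact ⟨Y, X, Z, hY, hX, hZ, by abel, fun y hy x hx z hz => hE.swap_left (h x hx y hy z hz)⟩
    · exact ⟨Z, X, Y, hZ, hX, hY, by abel, fun z hz x hx y hy =>
        hE.swap_left (hE.swap_right (h x hx y hy z hz))⟩
    · exact ⟨Z, Y, X, hZ, hY, hX, by abel, fun z hz y hy x hx =>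
        hE.swap_left (hE.swap_right (hE.swap_left (h x hx y hy z hz)))⟩
  | zero =>
    intro X Y Z hX hY hZ _
    simp only [Prod.fst_zero, Prod.snd_zero, Multiset.card_eq_zero] at hX hY hZ
    simp [hX, hY, hZ]
  | add s t _ _ hs ht =>
    intro X Y Z hX hY hZ h
    obtain ⟨X₁, X₂, rfl, hX₁, hX₂⟩ := exists_add_of_card_eq_add hX
    obtain ⟨Y₁, Y₂, rfl, hY₁, hY₂⟩ := exists_add_of_card_eq_add hY
    obtain ⟨Z₁, Z₂, rfl, hZ₁, hZ₂⟩ := exists_add_of_card_eq_add hZ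
    have h1 := hs X₁ Y₁ Z₁ hX₁ hY₁ hZ₁ fun x hx y hy z hz =>
      h x (Multiset.mem_add.2 (.inl hx)) y (Multiset.mem_add.2 (.inl hy)) z
        (Multiset.mem_add.2 (.inl hz))
    have h2 := ht X₂ Y₂ Z₂ hX₂ hY₂ hZ₂ fun x hx y hy z hz =>
      h x (Multiset.mem_add.2 (.inr hx)) y (Multiset.mem_add.2 (.inr hy)) z
        (Multiset.mem_add.2 (.inr hz))
    rw [show X₁ + X₂ + (Y₁ + Y₂) + (Z₁ + Z₂) = X₁ + Y₁ + Z₁ + (X₂ + Y₂ + Z₂) by abel]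
    exact AddSubmonoid.add_mem _ h1 h2

/-- If `b - a` and `c - b` are coprime, one element can be moved from one part to another. -/
lemma exists_partSizes {a b c : ℕ} (ha : 1 ≤ a) (hab : a ≤ b) (hbc : b ≤ c)
    (hd : Nat.gcd (b - a) (c - b) = 1) :
    ∃ p q r, 1 ≤ r ∧ (p + 1, q, r) ∈ partSizes a b c ∧ (p, q + 1, r) ∈ partSizes a b c := by
  have key : ∀ k ∈ AddSubgroup.closure {(b - a : ℤ), (c - b : ℤ)}, ∃ p q p' q' r : ℕ,
      (p, q, r) ∈ partSizes a b c ∧ (p', q', r) ∈ partSizes a b c ∧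
      (p : ℤ) = p' + k ∧ (q : ℤ) + k = q' := by
    intro k hk
    induction hk using AddSubgroup.closure_induction with
    | mem k hk =>
      rcases hk with rfl | rfl
      · exact ⟨b, a, a, b, c, AddSubmonoid.subset_closure (by simp),
          AddSubmonoid.subset_closure (by simp), by ring, by ring⟩
      · exact ⟨c, b, b, c, a, AddSubmonoid.subset_closure (by simp),
          AddSubmonoid.subset_closure (by simp), by ring, by ring⟩
    | zero => exact ⟨0, 0, 0, 0, 0, AddSubmonoid.zero_mem _, AddSubmonoid.zero_mem _, by simp,
        by simp⟩
    | add k l _ _ hk hl =>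
      obtain ⟨p, q, p', q', r, h1, h2, h3, h4⟩ := hk
      obtain ⟨s, t, s', t', w, h5, h6, h7, h8⟩ := hl
      exact ⟨p + s, q + t, p' + s', q' + t', r + w, AddSubmonoid.add_mem _ h1 h5,
        AddSubmonoid.add_mem _ h2 h6, by push_cast; linarith, by push_cast; linarith⟩
    | neg k _ hk =>
      obtain ⟨p, q, p', q', r, h1, h2, h3, h4⟩ := hk
      exact ⟨p', q', p, q, r, h2, h1, by linarith, by linarith⟩
  have h1 : (1 : ℤ) ∈ AddSubgroup.closure {(b - a : ℤ), (c - b : ℤ)} := by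
    have h2 := Nat.gcd_eq_gcd_ab (b - a) (c - b)
    rw [hd, Nat.cast_sub hab, Nat.cast_sub hbc, Nat.cast_one] at h2
    rw [h2, mul_comm, mul_comm ((c : ℤ) - b), ← smul_eq_mul, ← smul_eq_mul]
    exact add_mem (zsmul_mem (AddSubgroup.subset_closure (by simp)) _)
      (zsmul_mem (AddSubgroup.subset_closure (by simp)) _)
  obtain ⟨p, q, p', q', r, h3, h4, h5, h6⟩ := key 1 h1
  obtain rfl : p = p' + 1 := by omega
  obtain rfl : q' = q + 1 := by omega
  have h7 : (a, b, c) ∈ partSizes a b c := AddSubmonoid.subset_closure (by simp)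
  refine ⟨p' + a, q + b, r + c, by omega, ?_, ?_⟩
  · simpa [add_right_comm] using AddSubmonoid.add_mem _ h3 h7
  · simpa [add_right_comm] using AddSubmonoid.add_mem _ h4 h7

variable {V : Type*} [Fintype V] {E : V → V → V → Prop} {a b c : ℕ}

/-- If many edges contain a pair `x`, `y` with `A x` and `B y`, and parts of sizes `p + 1, q, r`
and `p, q + 1, r` can both be tiled, then many such pairs are exchangeable. -/
lemma density_exch_of_edges (hE : IsSymmetric E) {p q r : ℕ} (hr : 1 ≤ r)
    (h₁ : (p + 1, q, r) ∈ partSizes a b c) (h₂ : (p, q + 1, r) ∈ partSizes a b c) {θ : ℝ}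
    (hθ : 0 < θ) {A B : V → Prop}
    (h : θ ≤ density fun x : V × V × V => A x.1 ∧ B x.2.1 ∧ E x.1 x.2.1 x.2.2) :
    θ ^ ((p + 1) * (q + 1) * r) / 2 ≤ density fun x : V × V => A x.1 ∧ B x.2 ∧
      Exch (tileable E a b c) (θ ^ ((p + 1) * (q + 1) * r) / 2) (p + (q + r)) {x.1} {x.2} := by
  obtain ⟨x, -⟩ := exists_of_density_pos (hθ.trans_le h)
  have : Nonempty V := ⟨x.1⟩
  have h1 := pow_le_density_blowup₃ (ι := Fin (p + 1)) (κ := Fin (q + 1)) (ν := Fin r) hθ.le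
    (p := fun x y z => A x ∧ B y ∧ E x y z) h
  simp only [Fintype.card_fin] at h1
  let e : (V × V) × ((Fin p → V) × (Fin q → V) × (Fin r → V)) ≃
      (Fin (p + 1) → V) × (Fin (q + 1) → V) × (Fin r → V) :=
    { toFun := fun x => (Fin.cons x.1.1 x.2.1, Fin.cons x.1.2 x.2.2.1, x.2.2.2)
      invFun := fun y => ((y.1 0, y.2.1 0), (Fin.tail y.1, Fin.tail y.2.1, y.2.2))
      left_inv := fun x => by simp
      right_inv := fun y => by simp }
  rw [← density_equiv e] at h1
  have hpos : 0 < θ ^ ((p + 1) * (q + 1) * r) := pow_pos hθ _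
  refine (half_le_density_fiber h1).trans (density_mono fun x hx => ?_)
  have h3 : ∀ y, (∀ i j k, A ((e (x, y)).1 i) ∧ B ((e (x, y)).2.1 j) ∧
      E ((e (x, y)).1 i) ((e (x, y)).2.1 j) ((e (x, y)).2.2 k)) →
      (A x.1 ∧ B x.2) ∧ {x.1} + (tup y.1 + (tup y.2.1 + tup y.2.2)) ∈ tileable E a b c ∧
        {x.2} + (tup y.1 + (tup y.2.1 + tup y.2.2)) ∈ tileable E a b c := by
    intro y hy
    refine ⟨⟨(hy 0 0 ⟨0, hr⟩).1, (hy 0 0 ⟨0, hr⟩).2.1⟩, ?_, ?_⟩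
    · rw [show {x.1} + (tup y.1 + (tup y.2.1 + tup y.2.2)) =
        ({x.1} + tup y.1) + tup y.2.1 + tup y.2.2 by abel]
      refine mem_tileable_of_mem_partSizes hE h₁ _ _ _ (by simp [card_tup, add_comm])
        (by simp [card_tup]) (by simp [card_tup]) ?_
      intro u hu v hv w hw
      obtain ⟨j, rfl⟩ := mem_tup.1 hv
      obtain ⟨k, rfl⟩ := mem_tup.1 hw
      rcases Multiset.mem_add.1 hu with hu | hu
      · rw [Multiset.mem_singleton.1 hu]; exact (hy 0 j.succ k).2.2
      · obtain ⟨i, rfl⟩ := mem_tup.1 hu; exact (hy i.succ j.succ k).2.2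
    · rw [show {x.2} + (tup y.1 + (tup y.2.1 + tup y.2.2)) =
        tup y.1 + ({x.2} + tup y.2.1) + tup y.2.2 by abel]
      refine mem_tileable_of_mem_partSizes hE h₂ _ _ _ (by simp [card_tup])
        (by simp [card_tup, add_comm]) (by simp [card_tup]) ?_
      intro u hu v hv w hw
      obtain ⟨i, rfl⟩ := mem_tup.1 hu
      obtain ⟨k, rfl⟩ := mem_tup.1 hw
      rcases Multiset.mem_add.1 hv with hv | hv
      · rw [Multiset.mem_singleton.1 hv]; exact (hy i.succ 0 k).2.2
      · obtain ⟨j, rfl⟩ := mem_tup.1 hv; exact (hy i.succ j.succ k).2.2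
  obtain ⟨y, hy⟩ := exists_of_density_pos ((half_pos hpos).trans_le hx)
  exact ⟨(h3 y hy).1.1, (h3 y hy).1.2, exch_of_samples (samples_parts p q r) le_rfl
    (hx.trans (density_mono fun y hy => (h3 y hy).2))⟩

/-- A cut whose first side has at most half of the vertices is crossed by many edges. -/
lemma density_crossing_edges (hE : IsSymmetric E) {γ : ℝ}
    (hδ : ∀ v, 1 / 4 + γ ≤ density fun x : V × V => E v x.1 x.2) {A : V → Prop}
    (hA : density A ≤ 1 / 2) :
    density A * (γ / 2) ≤
      density fun x : V × V × V => A x.1 ∧ ¬ A x.2.1 ∧ E x.1 x.2.1 x.2.2 := by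
  refine mul_density_le_density_prod (q := fun v (x : V × V) => ¬ A x.1 ∧ E v x.1 x.2)
    fun v _ => ?_
  have h1 := density_split (fun x : V × V => E v x.1 x.2) fun x => A x.1 ∧ A x.2
  have h2 := density_mono (p := fun x : V × V => E v x.1 x.2 ∧ A x.1 ∧ A x.2)
    (q := fun x => A x.1 ∧ A x.2) fun x hx => hx.2
  rw [density_and_prod] at h2
  have h3 := density_le_add (p := fun x : V × V => E v x.1 x.2 ∧ ¬ (A x.1 ∧ A x.2))
    (q := fun x => ¬ A x.1 ∧ E v x.1 x.2) (r := fun x => ¬ A x.2 ∧ E v x.2 x.1) fun x hx => by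
      by_cases h : A x.1
      · exact Or.inr ⟨fun h' => hx.2 ⟨h, h'⟩, hE.swap_right hx.1⟩
      · exact Or.inl ⟨h, hx.1⟩
  have h4 := density_swap fun x : V × V => ¬ A x.1 ∧ E v x.1 x.2
  have h5 := hδ v
  have h6 := density_nonneg A
  simp only at h4
  nlinarith

/-- In every symmetric relation with link densities at least `δ`, every cut with two large sides is
crossed by many exchangeable pairs. -/
def CutsAreCrossed (a b c : ℕ) (δ : ℝ) : Prop :=
  ∀ ε : ℝ, 0 < ε → ∃ β : ℝ, 0 < β ∧ ∃ K : ℕ, ∀ (V : Type u) [Fintype V] (E : V → V → V → Prop),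
    IsSymmetric E → (∀ v, δ ≤ density fun x : V × V => E v x.1 x.2) → ∀ A : V → Prop,
    ε ≤ density A → (ε ≤ density fun v => ¬ A v) →
    β ≤ density fun x : V × V => A x.1 ∧ ¬ A x.2 ∧ Exch (tileable E a b c) β K {x.1} {x.2}

lemma cutsAreCrossed_of_coprime (ha : 1 ≤ a) (hab : a ≤ b) (hbc : b ≤ c)
    (hd : Nat.gcd (b - a) (c - b) = 1) {γ : ℝ} (hγ : 0 < γ) :
    CutsAreCrossed.{u} a b c (1 / 4 + γ) := by
  intro ε hε
  obtain ⟨p, q, r, hr, h₁, h₂⟩ := exists_partSizes ha hab hbc hd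
  have hθ : 0 < ε * (γ / 2) := by positivity
  refine ⟨(ε * (γ / 2)) ^ ((p + 1) * (q + 1) * r) / 2, by positivity, p + (q + r), ?_⟩
  intro V _ E hE hδ A hA hA'
  have key : ∀ B : V → Prop, ε ≤ density B → density B ≤ 1 / 2 → _ := fun B hB hB' =>
    density_exch_of_edges hE hr h₁ h₂ hθ (A := B) (B := fun v => ¬ B v)
      ((mul_le_mul_of_nonneg_right hB (by positivity)).trans (density_crossing_edges hE hδ hB'))
  rcases le_or_gt (density A) (1 / 2) with h | h
  · exact key A hA h
  · obtain ⟨v, -⟩ := exists_of_density_pos (hε.trans_le hA)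
    have : Nonempty V := ⟨v⟩
    have h1 := density_not A
    refine (key (fun v => ¬ A v) hA' (by linarith)).trans_eq ?_
    rw [density_swap]
    exact density_congr fun x => ⟨fun hx => ⟨not_not.1 hx.2.1, hx.1, hx.2.2.symm⟩,
      fun hx => ⟨hx.2.1, not_not.2 hx.1, hx.2.2.symm⟩⟩

end CoprimeCut

/-! ### Blocks with prescribed numbers of vertices on one side of a cut -/

section Values

variable {V : Type*} [Fintype V]

open Classical in
/-- `HasValue C B κ k v`: a proportion at least `κ` of the `k`-tuples lies in `C` and has exactly
`v` entries in `B`. -/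
def HasValue (C : AddSubmonoid (Multiset V)) (B : V → Prop) (κ : ℝ) (k v : ℕ) : Prop :=
  κ ≤ density fun s : Fin k → V => tup s ∈ C ∧ (tup s).countP B = v

variable {C : AddSubmonoid (Multiset V)} {B : V → Prop} {κ κ' : ℝ} {k k' v v' : ℕ}

lemma HasValue.add (hκ' : 0 ≤ κ') (h : HasValue C B κ k v) (h' : HasValue C B κ' k' v') :
    HasValue C B (κ * κ') (k + k') (v + v') := by
  classical
  have h1 := (samples_fin (V := V) k).prod (samples_fin k')
    fun M => M ∈ C ∧ M.countP B = v + v'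
  refine ((mul_le_mul h h' hκ' (density_nonneg _)).trans ?_).trans_eq
    (h1.trans (density_congr fun s => by congr!))
  rw [← density_and_prod]
  refine density_mono fun x hx => ⟨C.add_mem hx.1.1 hx.2.1, ?_⟩
  rw [Multiset.countP_add]
  congr 1
  · rw [← hx.1.2]
  · rw [← hx.2.2]

lemma hasValue_zero : HasValue C B 1 0 0 := by
  simp [HasValue, tup, density_true, C.zero_mem]

lemma hasValue_sum (hκ : 0 ≤ κ) {P : Multiset ℕ} (h : ∀ v ∈ P, HasValue C B κ k v) :
    HasValue C B (κ ^ P.card) (P.card * k) P.sum := by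
  induction P using Multiset.induction_on with
  | empty => simpa using hasValue_zero
  | cons v P ih =>
    have h1 := (h v (Multiset.mem_cons_self v P)).add (pow_nonneg hκ _)
      (ih fun w hw => h w (Multiset.mem_cons_of_mem hw))
    rw [Multiset.card_cons, Multiset.sum_cons, pow_succ', Nat.succ_mul, add_comm (P.card * k)]
    exact h1

/-- The positions of the entries in `B` can be prescribed. -/
lemma HasValue.pattern {n : ℕ} (hκ : 0 < κ) (h : HasValue C B κ n v) {J : Finset (Fin n)}
    (hJ : #J = v) :
    κ / 2 ^ n ≤ density fun s : Fin n → V => tup s ∈ C ∧ ∀ i, B (s i) ↔ i ∈ J := by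
  classical
  obtain ⟨I, hI, h1⟩ := exists_density_le_of_exists (s := univ.powerset.filter fun I => #I = v)
    (q := fun (I : Finset (Fin n)) (s : Fin n → V) => tup s ∈ C ∧ ∀ i, B (s i) ↔ i ∈ I) hκ h
    fun s hs => by
      refine ⟨univ.filter fun i => B (s i), ?_, hs.1, by simp⟩
      have h2 : (tup s).countP B = #(univ.filter fun i => B (s i)) := by
        rw [tup, ← Multiset.coe_countPAddMonoidHom, map_sum]
        simp only [Multiset.coe_countPAddMonoidHom, Multiset.countP_eq_card_filter,
          Multiset.filter_singleton, card_filter]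
        exact sum_congr rfl fun i _ => by split_ifs <;> simp
      simp only [powerset_univ, mem_filter, mem_univ, true_and]
      rw [← hs.2, ← h2]
  have hI' : #I = #J := by
    rw [hJ]; simpa using hI
  let e : {x // x ∈ I} ≃ {x // x ∈ J} := Finset.equivOfCardEq hI'
  let σ : Equiv.Perm (Fin n) := e.extendSubtype
  have hσ : ∀ i, σ i ∈ J ↔ i ∈ I := fun i =>
    ⟨fun h => by_contra fun h' => e.extendSubtype_not_mem i h' h, fun h => e.extendSubtype_mem i h⟩
  rw [← density_equiv (σ.symm.arrowCongr (Equiv.refl V)).symm]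
  refine le_trans ?_ (h1.trans (density_mono fun s hs => ⟨?_, fun i => ?_⟩))
  · refine div_le_div_of_nonneg_left hκ.le ?_ ?_
    · exact_mod_cast card_pos.2 ⟨I, hI⟩
    · have h3 := (card_filter_le (univ.powerset : Finset (Finset (Fin n))) fun I => #I = v)
      rw [card_powerset, card_univ, Fintype.card_fin] at h3
      exact_mod_cast h3
  · have : tup ((σ.symm.arrowCongr (Equiv.refl V)).symm s) = tup s :=
      Fintype.sum_equiv σ.symm _ _ fun i => by simp [Equiv.arrowCongr]
    rw [this]; exact hs.1
  · have h3 := hs.2 (σ.symm i)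
    rw [← hσ, Equiv.apply_symm_apply] at h3
    simpa [Equiv.arrowCongr] using h3

/-- Two random elements of `C` of the same size, one with `h + 1` entries in `B` and the other one
with `h`, can be paired up such that all pairs but one are on the same side of the cut `B`. If most
such pairs are exchangeable, then so are many of the remaining pairs, which cross the cut. -/
lemma density_exch_of_hasValue {h K : ℕ} {c ε : ℝ} (hhk : h ≤ k) (hκ : 0 < κ) (hc : 0 < c)
    (h₁ : HasValue C B κ (k + 1) (h + 1)) (h₂ : HasValue C B κ (k + 1) h)
    (hB : (density fun x : V × V => B x.1 ∧ B x.2 ∧ ¬ Exch C c K {x.1} {x.2}) ≤ ε)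
    (hA : (density fun x : V × V => ¬ B x.1 ∧ ¬ B x.2 ∧ ¬ Exch C c K {x.1} {x.2}) ≤ ε)
    (hε : k * (2 * ε) ≤ (κ / 2 ^ (k + 1)) ^ 2 / 2) :
    (κ / 2 ^ (k + 1)) ^ 2 / 4 ≤ density fun x : V × V => B x.1 ∧ ¬ B x.2 ∧
      Exch C ((κ / 2 ^ (k + 1)) ^ 2 / 4 / ((k * K : ℕ) + 1) * c ^ k) (k + k + k * K)
        {x.1} {x.2} := by
  set κ' := κ / 2 ^ (k + 1)
  have hκ' : 0 < κ' := by positivity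
  let J : Finset (Fin (k + 1)) := univ.filter fun i => i.val < h + 1
  have hJ : #J = h + 1 := by
    rw [Fin.card_filter_val_lt]; omega
  have h0 : (0 : Fin (k + 1)) ∈ J := by simp [J]
  have p₁ := h₁.pattern hκ hJ
  have p₂ := h₂.pattern hκ (J := J.erase 0) (by rw [card_erase_of_mem h0, hJ]; rfl)
  have h3 : κ' ^ 2 ≤ density fun x : (Fin (k + 1) → V) × (Fin (k + 1) → V) =>
      (tup x.1 ∈ C ∧ ∀ i, B (x.1 i) ↔ i ∈ J) ∧ (tup x.2 ∈ C ∧ ∀ i, B (x.2 i) ↔ i ∈ J.erase 0) := by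
    rw [density_and_prod (fun s : Fin (k + 1) → V => tup s ∈ C ∧ ∀ i, B (s i) ↔ i ∈ J)
      (fun s : Fin (k + 1) → V => tup s ∈ C ∧ ∀ i, B (s i) ↔ i ∈ J.erase 0), sq]
    exact mul_le_mul p₁ p₂ hκ'.le (density_nonneg _)
  obtain ⟨x₀, -⟩ := exists_of_density_pos ((pow_pos hκ' 2).trans_le h3)
  have : Nonempty V := ⟨x₀.1 0⟩
  have h4 := density_split (fun x : (Fin (k + 1) → V) × (Fin (k + 1) → V) =>
      (tup x.1 ∈ C ∧ ∀ i, B (x.1 i) ↔ i ∈ J) ∧ (tup x.2 ∈ C ∧ ∀ i, B (x.2 i) ↔ i ∈ J.erase 0))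
    fun x => ∀ i : Fin k, Exch C c K {x.1 i.succ} {x.2 i.succ}
  have h5 : (density fun x : (Fin (k + 1) → V) × (Fin (k + 1) → V) =>
      ((tup x.1 ∈ C ∧ ∀ i, B (x.1 i) ↔ i ∈ J) ∧ (tup x.2 ∈ C ∧ ∀ i, B (x.2 i) ↔ i ∈ J.erase 0)) ∧
      ¬ ∀ i : Fin k, Exch C c K {x.1 i.succ} {x.2 i.succ}) ≤ k * (2 * ε) := by
    refine (density_sum_le (univ : Finset (Fin k)) (q := fun i x =>
      (B (x.1 i.succ) ∧ B (x.2 i.succ) ∧ ¬ Exch C c K {x.1 i.succ} {x.2 i.succ}) ∨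
      (¬ B (x.1 i.succ) ∧ ¬ B (x.2 i.succ) ∧ ¬ Exch C c K {x.1 i.succ} {x.2 i.succ}))
      fun x hx => ?_).trans ?_
    · obtain ⟨i, hi⟩ := not_forall.1 hx.2
      have h6 := hx.1.1.2 i.succ
      have h7 := hx.1.2.2 i.succ
      rw [mem_erase] at h7
      have h8 := Fin.succ_ne_zero i
      exact ⟨i, mem_univ i, by tauto⟩
    · calc _ ≤ ∑ _i : Fin k, (2 * ε) := sum_le_sum fun i _ => by
            rw [density_apply_apply i.succ i.succ fun u v =>
              (B u ∧ B v ∧ ¬ Exch C c K {u} {v}) ∨ (¬ B u ∧ ¬ B v ∧ ¬ Exch C c K {u} {v})]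
            refine (density_or_le _ _).trans ?_
            linarith
        _ = _ := by simp
  let e : (V × V) × ((Fin k → V) × (Fin k → V)) ≃ (Fin (k + 1) → V) × (Fin (k + 1) → V) :=
    { toFun := fun x => (Fin.cons x.1.1 x.2.1, Fin.cons x.1.2 x.2.2)
      invFun := fun y => ((y.1 0, y.2 0), (Fin.tail y.1, Fin.tail y.2))
      left_inv := fun x => by simp
      right_inv := fun y => by simp }
  have h6 : κ' ^ 2 / 2 ≤ _ := (show κ' ^ 2 / 2 ≤ _ by linarith : κ' ^ 2 / 2 ≤ density fun x :
    (Fin (k + 1) → V) × (Fin (k + 1) → V) => ((tup x.1 ∈ C ∧ ∀ i, B (x.1 i) ↔ i ∈ J) ∧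
    (tup x.2 ∈ C ∧ ∀ i, B (x.2 i) ↔ i ∈ J.erase 0)) ∧
    ∀ i : Fin k, Exch C c K {x.1 i.succ} {x.2 i.succ})
  rw [← density_equiv e] at h6
  have h7 : κ' ^ 2 / 2 / 2 = κ' ^ 2 / 4 := by ring
  rw [← h7]
  refine (half_le_density_fiber h6).trans (density_mono fun x hx => ?_)
  have hpos : 0 < κ' ^ 2 / 2 / 2 := by positivity
  have h8 : ∀ (v : V) (s : Fin k → V), tup (Fin.cons v s : Fin (k + 1) → V) = {v} + tup s :=
    fun v s => by simp [tup, Fin.sum_univ_succ]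
  obtain ⟨y, hy⟩ := exists_of_density_pos (hpos.trans_le hx)
  refine ⟨(hy.1.1.2 0).2 h0, fun h => ?_, ?_⟩
  · simpa using (hy.1.2.2 0).1 h
  · have h9 := exch_of_paired (P := {x.1}) (Q := {x.2}) hpos hc.le
      (hx.trans (density_mono fun y hy => ⟨by rw [← h8]; exact hy.1.1.1,
        by rw [← h8]; exact hy.1.2.1, hy.2⟩))
    simpa using h9

end Values

section Arithmetic

lemma exists_multisets_of_one_mem {S : Set ℕ}
    (h : (1 : ℤ) ∈ AddSubgroup.closure {k : ℤ | ∃ s ∈ S, ∃ t ∈ S, k = s - t}) :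
    ∃ P Q : Multiset ℕ, (∀ s ∈ P, s ∈ S) ∧ (∀ s ∈ Q, s ∈ S) ∧ P.card = Q.card ∧
      P.sum = Q.sum + 1 := by
  have key : ∀ k ∈ AddSubgroup.closure {k : ℤ | ∃ s ∈ S, ∃ t ∈ S, k = s - t},
      ∃ P Q : Multiset ℕ, (∀ s ∈ P, s ∈ S) ∧ (∀ s ∈ Q, s ∈ S) ∧ P.card = Q.card ∧
      (P.sum : ℤ) = Q.sum + k := by
    intro k hk
    induction hk using AddSubgroup.closure_induction with
    | mem k hk =>
      obtain ⟨s, hs, t, ht, rfl⟩ := hk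
      exact ⟨{s}, {t}, by simpa using hs, by simpa using ht, by simp, by simp⟩
    | zero => exact ⟨0, 0, by simp, by simp, rfl, by simp⟩
    | add k l _ _ hk hl =>
      obtain ⟨P, Q, h1, h2, h3, h4⟩ := hk
      obtain ⟨P', Q', h5, h6, h7, h8⟩ := hl
      refine ⟨P + P', Q + Q', fun s hs => ?_, fun s hs => ?_, by simp [h3, h7], ?_⟩
      · exact (Multiset.mem_add.1 hs).elim (h1 s) (h5 s)
      · exact (Multiset.mem_add.1 hs).elim (h2 s) (h6 s)
      · rw [Multiset.sum_add, Multiset.sum_add, Nat.cast_add, Nat.cast_add, h4, h8]; ring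
    | neg k _ hk =>
      obtain ⟨P, Q, h1, h2, h3, h4⟩ := hk
      exact ⟨Q, P, h2, h1, h3.symm, by linarith⟩
  obtain ⟨P, Q, h1, h2, h3, h4⟩ := key 1 h
  exact ⟨P, Q, h1, h2, h3, by exact_mod_cast h4⟩

variable {a b c : ℕ}

lemma exists_multisets_of_coprime {z y : ℕ} (hy : y ∈ ({a, b, c} : Set ℕ))
    (h : ∀ g : ℤ, g ∣ b - a → g ∣ c - b → g ∣ z - y → g ∣ 1) :
    ∃ P Q : Multiset ℕ, (∀ s ∈ P, s ∈ ({a, b, c, z} : Set ℕ)) ∧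
      (∀ s ∈ Q, s ∈ ({a, b, c, z} : Set ℕ)) ∧ P.card = Q.card ∧ P.sum = Q.sum + 1 := by
  apply exists_multisets_of_one_mem
  set G := AddSubgroup.closure {k : ℤ | ∃ s ∈ ({a, b, c, z} : Set ℕ), ∃ t ∈ ({a, b, c, z} : Set ℕ),
    k = s - t}
  obtain ⟨g, hg⟩ := Int.subgroup_cyclic G
  rw [← AddSubgroup.zmultiples_eq_closure] at hg
  have hmem : ∀ k : ℤ, k ∈ G ↔ g ∣ k := fun k => by rw [hg, Int.mem_zmultiples_iff]
  rw [hmem]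
  refine h g ?_ ?_ ?_ <;> rw [← hmem] <;> apply AddSubgroup.subset_closure
  · exact ⟨b, by simp, a, by simp, rfl⟩
  · exact ⟨c, by simp, b, by simp, rfl⟩
  · refine ⟨z, by simp, y, ?_, rfl⟩
    rcases hy with rfl | rfl | rfl <;> simp

/-- For each of the three values `z` there are two collections of `N` numbers from `a`, `b`, `c`,
`z` whose sums differ by one. -/
lemma exists_multisets (hab : a ≤ b) (hbc : b ≤ c) (h₁ : Nat.gcd (Nat.gcd a b) c = 1)
    (h₂ : Odd (Nat.gcd (b - a) (c - b))) :
    ∃ N : ℕ, 1 ≤ N ∧ ∀ z ∈ ({0, b + c, a + b + c} : Set ℕ), ∃ P Q : Multiset ℕ,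
      (∀ s ∈ P, s ∈ ({a, b, c, z} : Set ℕ)) ∧ (∀ s ∈ Q, s ∈ ({a, b, c, z} : Set ℕ)) ∧
      P.card = N ∧ Q.card = N ∧ P.sum = Q.sum + 1 := by
  have hg : ∀ g : ℤ, g ∣ a → g ∣ b → g ∣ c → g ∣ 1 := fun g ha hb hc => by
    rw [← Int.natAbs_dvd_natAbs] at *
    simp only [Int.natAbs_natCast, Int.natAbs_one] at *
    rw [← h₁]
    exact Nat.dvd_gcd (Nat.dvd_gcd ha hb) hc
  obtain ⟨P₁, Q₁, h11, h12, h13, h14⟩ :=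
    exists_multisets_of_coprime (a := a) (b := b) (c := c) (z := 0) (y := a)
    (by simp) fun g hg1 hg2 hg3 => by
      have ha : g ∣ a := by simpa using hg3
      have hb : g ∣ b := (dvd_sub_left ha).1 hg1
      exact hg g ha hb ((dvd_sub_left hb).1 hg2)
  obtain ⟨P₂, Q₂, h21, h22, h23, h24⟩ :=
    exists_multisets_of_coprime (a := a) (b := b) (c := c) (z := b + c) (y := b)
    (by simp) fun g hg1 hg2 hg3 => by
      have hc : g ∣ c := by simpa using hg3
      have hb : g ∣ b := (dvd_sub_right hc).1 hg2
      exact hg g ((dvd_sub_right hb).1 hg1) hb hc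
  obtain ⟨P₃, Q₃, h31, h32, h33, h34⟩ :=
    exists_multisets_of_coprime (a := a) (b := b) (c := c) (z := a + b + c) (y := a)
    (by simp) fun g hg1 hg2 hg3 => by
      have h2b : g ∣ 2 * b := by
        have : (2 * b : ℤ) = ((a + b + c : ℕ) - a) - (c - b) := by push_cast; ring
        rw [this]; exact dvd_sub hg3 hg2
      have hodd : IsCoprime g 2 := by
        have h5 : g ∣ (Nat.gcd (b - a) (c - b) : ℕ) := by
          rw [← Int.natAbs_dvd_natAbs] at hg1 hg2 ⊢
          rw [← Nat.cast_sub hab, Int.natAbs_natCast] at hg1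
          rw [← Nat.cast_sub hbc, Int.natAbs_natCast] at hg2
          exact Nat.dvd_gcd hg1 hg2
        obtain ⟨k, hk⟩ := h₂
        obtain ⟨l, hl⟩ := h5
        exact ⟨l, -k, by rw [mul_comm l, ← hl, hk]; push_cast; ring⟩
      have hb : g ∣ b := hodd.dvd_of_dvd_mul_left h2b
      exact hg g ((dvd_sub_right hb).1 hg1) hb ((dvd_sub_left hb).1 hg2)
  -- all three pairs of collections are brought to the same size by adding copies of `a`
  have pad : ∀ {z : ℕ} {P Q : Multiset ℕ} (n : ℕ), (∀ s ∈ P, s ∈ ({a, b, c, z} : Set ℕ)) →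
      (∀ s ∈ Q, s ∈ ({a, b, c, z} : Set ℕ)) → P.card = Q.card → P.sum = Q.sum + 1 →
      ∃ P' Q' : Multiset ℕ, (∀ s ∈ P', s ∈ ({a, b, c, z} : Set ℕ)) ∧
        (∀ s ∈ Q', s ∈ ({a, b, c, z} : Set ℕ)) ∧ P'.card = P.card + n ∧ Q'.card = P.card + n ∧
        P'.sum = Q'.sum + 1 := by
    intro z P Q n hP hQ hc hs
    refine ⟨P + Multiset.replicate n a, Q + Multiset.replicate n a, fun s hs => ?_, fun s hs => ?_,
      by simp, by simp [hc], by simp [hs]; ring⟩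
    · rcases Multiset.mem_add.1 hs with h | h
      · exact hP s h
      · rw [Multiset.eq_of_mem_replicate h]; simp
    · rcases Multiset.mem_add.1 hs with h | h
      · exact hQ s h
      · rw [Multiset.eq_of_mem_replicate h]; simp
  refine ⟨P₁.card + (P₂.card + P₃.card + 1), by omega, ?_⟩
  rintro z (rfl | rfl | rfl)
  · exact pad _ h11 h12 h13 h14
  · obtain ⟨P, Q, h1, h2, h3, h4, h5⟩ := pad (P₁.card + P₃.card + 1) h21 h22 h23 h24
    exact ⟨P, Q, h1, h2, by omega, by omega, h5⟩
  · obtain ⟨P, Q, h1, h2, h3, h4, h5⟩ := pad (P₁.card + P₂.card + 1) h31 h32 h33 h34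
    exact ⟨P, Q, h1, h2, by omega, by omega, h5⟩

end Arithmetic

/-! ### Types of edges across a cut -/

section Types

variable {V : Type*} [Fintype V] {E : V → V → V → Prop} {B : V → Prop}

/-- The side of the cut `B` with index `i`: the vertices in `B` for `true`, the others for
`false`. -/
def side (B : V → Prop) (i : Bool) (v : V) : Prop := B v ↔ i = true

/-- The proportion of the ordered triples that are edges with vertices on the prescribed sides of
the cut `B`. -/
noncomputable def typeDensity (E : V → V → V → Prop) (B : V → Prop) (i j k : Bool) : ℝ :=
  density fun x : V × V × V =>
    (side B i x.1 ∧ side B j x.2.1 ∧ side B k x.2.2) ∧ E x.1 x.2.1 x.2.2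

lemma typeDensity_rotate (hE : IsSymmetric E) (i j k : Bool) :
    typeDensity E B i j k = typeDensity E B j k i := by
  rw [typeDensity, density_rotate]
  refine density_congr fun x => ⟨fun h => ⟨⟨h.1.2.1, h.1.2.2, h.1.1⟩, ?_⟩,
    fun h => ⟨⟨h.1.2.2, h.1.1, h.1.2.1⟩, ?_⟩⟩
  · exact hE.swap_right (hE.swap_left h.2)
  · exact hE.swap_left (hE.swap_right h.2)

lemma typeDensity_not (i j k : Bool) :
    typeDensity E (fun v => ¬ B v) i j k = typeDensity E B (!i) (!j) (!k) := by
  have h : ∀ i v, side (fun v => ¬ B v) i v ↔ side B (!i) v := fun i v => by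
    cases i <;> simp [side]
  simp only [typeDensity, h]

lemma typeDensity_le (i j k : Bool) :
    typeDensity E B i j k ≤ density (side B i) * (density (side B j) * density (side B k)) := by
  rw [← density_and_prod, ← density_and_prod (side B i)
    fun x : V × V => side B j x.1 ∧ side B k x.2]
  exact density_mono fun x hx => hx.1

/-- Summing the links of the vertices on one side gives the edges of the four types that have a
vertex on this side. -/
lemma density_side_mul_le {δ : ℝ} (hδ : ∀ v, δ ≤ density fun x : V × V => E v x.1 x.2) (i : Bool) :
    density (side B i) * δ ≤ typeDensity E B i false false + typeDensity E B i false true +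
      (typeDensity E B i true false + typeDensity E B i true true) := by
  refine (mul_density_le_density_prod (q := fun v (x : V × V) => E v x.1 x.2)
    fun v _ => hδ v).trans ?_
  rw [density_split _ fun x : V × V × V => B x.2.1]
  rw [density_split (fun x : V × V × V => (side B i x.1 ∧ E x.1 x.2.1 x.2.2) ∧ B x.2.1)
    fun x => B x.2.2, density_split (fun x : V × V × V => (side B i x.1 ∧ E x.1 x.2.1 x.2.2) ∧
    ¬ B x.2.1) fun x => B x.2.2]
  have h1 : ∀ v, side B true v ↔ B v := fun v => by simp [side]
  have h2 : ∀ v, side B false v ↔ ¬ B v := fun v => by simp [side]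
  simp only [typeDensity, h1, h2]
  refine le_of_eq ?_
  rw [add_comm, add_comm (density _)]
  refine congrArg₂ _ (congrArg₂ _ ?_ ?_) ?_
  · exact density_congr fun x => by tauto
  · exact density_congr fun x => by tauto
  · rw [add_comm]
    refine congrArg₂ _ ?_ ?_
    · exact density_congr fun x => by tauto
    · exact density_congr fun x => by tauto

lemma lt_typeDensity_crossing [Nonempty V] (hE : IsSymmetric E) {ε : ℝ} (hε : 0 < ε)
    (hδ : ∀ v, 4 / 9 ≤ density fun x : V × V => E v x.1 x.2)
    (hB : ε ≤ density B) (hB' : ε ≤ density fun v => ¬ B v) :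
    ε / 20 < typeDensity E B false false true + typeDensity E B false true true := by
  have key : ∀ A : V → Prop, ε ≤ density A → density A ≤ 1 / 2 →
      ε / 20 < density fun x : V × V × V => A x.1 ∧ ¬ A x.2.1 ∧ E x.1 x.2.1 x.2.2 := by
    intro A hA hA'
    have := density_crossing_edges hE (γ := 7 / 36) (fun v => by linarith [hδ v]) hA'
    linarith
  have h0 := density_not B
  have h1 : ∀ v, side B true v ↔ B v := fun v => by simp [side]
  have h2 : ∀ v, side B false v ↔ ¬ B v := fun v => by simp [side]
  rcases le_or_gt (density B) (1 / 2) with h | h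
  · refine (key B hB h).trans_le ?_
    rw [← typeDensity_rotate hE true false false, ← typeDensity_rotate hE true false true]
    refine density_le_add fun x hx => ?_
    simp only [h1, h2]
    tauto
  · refine (key (fun v => ¬ B v) hB' (by linarith)).trans_le ?_
    rw [← typeDensity_rotate hE true false false, ← typeDensity_rotate hE false true false]
    refine density_le_add fun x hx => ?_
    simp only [h1, h2]
    tauto

/-- The edges with exactly one vertex in `B` cannot be the only frequent ones: the links of the
vertices in `B` would force the complement of `B` to have density more than `2 / 3`, and then the
average link of the vertices outside `B` would have density less than `4 / 9`. -/
lemma le_typeDensity_of_four_ninths [Nonempty V] (hE : IsSymmetric E) {ε γ θ : ℝ} (hε : 0 < ε)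
    (hγ : 0 < γ) (hθ : θ ≤ ε * γ / 8)
    (hδ : ∀ v, 4 / 9 + γ ≤ density fun x : V × V => E v x.1 x.2)
    (hB : ε ≤ density B) (hB' : ε ≤ density fun v => ¬ B v) :
    θ ≤ typeDensity E B false false false ∨ θ ≤ typeDensity E B false true true ∨
      θ ≤ typeDensity E B true true true := by
  by_contra! h
  obtain ⟨h0, h2, h3⟩ := h
  have h4 := density_side_mul_le (B := B) hδ true
  have h5 := density_side_mul_le (B := B) hδ false
  have e1 : side B true = B := funext fun v => by simp [side]
  have e2 : side B false = fun v => ¬ B v := funext fun v => by simp [side]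
  have h6 := typeDensity_le (E := E) (B := B) true false false
  have h7 := typeDensity_le (E := E) (B := B) false false true
  have h8 := typeDensity_le (E := E) (B := B) false true false
  have h9 := density_not B
  rw [typeDensity_rotate hE true false true, typeDensity_rotate hE true true false,
    typeDensity_rotate hE true false true] at h4
  rw [e1] at h4 h6 h7 h8
  rw [e2, h9] at h5 h6 h7 h8
  rw [h9] at hB'
  generalize density B = β at *
  have hα1 : (4 / 9 : ℝ) < (1 - β) * (1 - β) := by
    have : β * (4 / 9 + γ) ≤ β * ((1 - β) * (1 - β)) + 3 * θ := by linarith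
    by_contra! hcon
    nlinarith
  have hα2 : (4 / 9 : ℝ) < 2 * ((1 - β) * β) := by
    have : (1 - β) * (4 / 9 + γ) ≤ (1 - β) * (2 * ((1 - β) * β)) + 2 * θ := by nlinarith
    by_contra! hcon
    nlinarith
  nlinarith

end Types

/-! ### Crossing a cut in the odd case -/

section OddCut

variable {V : Type*} [Fintype V] {E : V → V → V → Prop} {B : V → Prop} {a b c : ℕ}

lemma hasValue_of_typeDensity (ha : 1 ≤ a) (hb : 1 ≤ b) (hc : 1 ≤ c) {θ : ℝ} (hθ : 0 < θ)
    {i j k : Bool} (h : θ ≤ typeDensity E B i j k) :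
    HasValue (tileable E a b c) B (θ ^ (a * b * c)) (a + (b + c))
      ((if i then a else 0) + ((if j then b else 0) + (if k then c else 0))) := by
  classical
  obtain ⟨x, -⟩ := exists_of_density_pos (hθ.trans_le h)
  have : Nonempty V := ⟨x.1⟩
  have h1 := pow_le_density_blowup₃ (ι := Fin a) (κ := Fin b) (ν := Fin c) hθ.le
    (p := fun x y z => (side B i x ∧ side B j y ∧ side B k z) ∧ E x y z) h
  simp only [Fintype.card_fin] at h1
  have h2 : ∀ {n : ℕ} {i : Bool} {s : Fin n → V}, (∀ l, side B i (s l)) →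
      (tup s).countP B = if i then n else 0 := by
    intro n i s hs
    cases i
    · simp only [Bool.false_eq_true, if_false]
      refine Multiset.countP_eq_zero.2 fun v hv => ?_
      obtain ⟨l, rfl⟩ := mem_tup.1 hv
      simpa [side] using hs l
    · simp only [if_true]
      rw [Multiset.countP_eq_card.2, card_tup, Fintype.card_fin]
      intro v hv
      obtain ⟨l, rfl⟩ := mem_tup.1 hv
      simpa [side] using hs l
  refine (h1.trans ?_).trans_eq (samples_parts a b c fun M => M ∈ tileable E a b c ∧
    M.countP B = (if i then a else 0) + ((if j then b else 0) + (if k then c else 0)))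
  refine density_mono fun x hx => ⟨IsBlock.mem_tileable ⟨tup x.1, tup x.2.1, tup x.2.2,
    by simp [card_tup], by simp [card_tup], by simp [card_tup], (add_assoc _ _ _).symm, ?_⟩, ?_⟩
  · intro u hu v hv w hw
    obtain ⟨l, rfl⟩ := mem_tup.1 hu
    obtain ⟨l', rfl⟩ := mem_tup.1 hv
    obtain ⟨l'', rfl⟩ := mem_tup.1 hw
    exact (hx l l' l'').2
  · rw [Multiset.countP_add, Multiset.countP_add,
      h2 fun l => (hx l ⟨0, hb⟩ ⟨0, hc⟩).1.1, h2 fun l => (hx ⟨0, ha⟩ l ⟨0, hc⟩).1.2.1,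
      h2 fun l => (hx ⟨0, ha⟩ ⟨0, hb⟩ l).1.2.2]

/-- Among three sets of density `4 / 9` two have a large intersection. -/
lemma le_density_and_of_three {Ω : Type*} [Fintype Ω] {p q r : Ω → Prop} {ζ : ℝ} (hζ : ζ ≤ 1 / 20)
    (hp : 4 / 9 ≤ density p) (hq : 4 / 9 ≤ density q) (hr : 4 / 9 ≤ density r) :
    2 * ζ ≤ (density fun x => p x ∧ q x) ∨ 2 * ζ ≤ (density fun x => p x ∧ r x) ∨
      2 * ζ ≤ (density fun x => q x ∧ r x) := by
  by_contra! h
  have h1 := density_or_add_and p q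
  have h2 := density_or_add_and (fun x => p x ∨ q x) r
  have h3 := density_le_one fun x => (p x ∨ q x) ∨ r x
  have h4 := density_le_add (p := fun x => (p x ∨ q x) ∧ r x) (q := fun x => p x ∧ r x)
    (r := fun x => q x ∧ r x) fun x hx => by tauto
  linarith [h.1, h.2.1, h.2.2]

/-- If few exchangeable pairs cross the cut between `A` and `B`, then most pairs in `A` are
exchangeable. -/
lemma density_not_exch_mul_le {A : V → Prop} {R : V → V → Prop} (hE : IsSymmetric E) {ζ β ε : ℝ}
    (hζ : 0 < ζ) (hζ' : ζ ≤ 1 / 20)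
    (hδ : ∀ v, 4 / 9 ≤ density fun x : V × V => E v x.1 x.2)
    (hR : ∀ u v, ¬ Exceptional E ζ u →
      2 * ζ ≤ (density fun x : V × V => E u x.1 x.2 ∧ E v x.1 x.2) → R u v)
    (hB : ε ≤ density B) (hβ : (density fun x : V × V => A x.1 ∧ B x.2 ∧ R x.1 x.2) ≤ β) :
    (density fun x : V × V => A x.1 ∧ A x.2 ∧ ¬ R x.1 x.2) * ε ≤ 6 * ζ + 2 * β := by
  rcases isEmpty_or_nonempty V with hV | hV
  · have h1 : (density fun x : V × V => A x.1 ∧ A x.2 ∧ ¬ R x.1 x.2) = 0 := by simp [density]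
    have h2 := (density_nonneg _).trans hβ
    rw [h1, zero_mul]
    positivity
  have hX := density_exceptional_le hE hζ
  calc _ ≤ (density fun x : V × V => A x.1 ∧ A x.2 ∧ ¬ R x.1 x.2) * density B :=
        mul_le_mul_of_nonneg_left hB (density_nonneg _)
    _ = density fun x : (V × V) × V => (A x.1.1 ∧ A x.1.2 ∧ ¬ R x.1.1 x.1.2) ∧ B x.2 :=
        (density_and_prod (fun x : V × V => A x.1 ∧ A x.2 ∧ ¬ R x.1 x.2) B).symm
    _ ≤ (density fun x : (V × V) × V => Exceptional E ζ x.1.1 ∨ Exceptional E ζ x.1.2) +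
        density fun x : (V × V) × V => (A x.1.1 ∧ B x.2 ∧ R x.1.1 x.2) ∨
          (A x.1.2 ∧ B x.2 ∧ R x.1.2 x.2) := by
        refine density_le_add fun x hx => ?_
        by_cases h1 : Exceptional E ζ x.1.1
        · exact Or.inl (Or.inl h1)
        by_cases h2 : Exceptional E ζ x.1.2
        · exact Or.inl (Or.inr h2)
        rcases le_density_and_of_three hζ' (hδ x.1.1) (hδ x.1.2) (hδ x.2) with h | h | h
        · exact absurd (hR _ _ h1 h) hx.1.2.2
        · exact Or.inr (Or.inl ⟨hx.1.1, hx.2, hR _ _ h1 h⟩)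
        · exact Or.inr (Or.inr ⟨hx.1.2.1, hx.2, hR _ _ h2 h⟩)
    _ ≤ (3 * ζ + 3 * ζ) + (β + β) := by
        refine add_le_add ((density_or_le _ _).trans (add_le_add ?_ ?_))
          ((density_or_le _ _).trans (add_le_add ?_ ?_))
        · rw [density_fst fun x : V × V => Exceptional E ζ x.1, density_fst]; exact hX
        · rw [density_fst fun x : V × V => Exceptional E ζ x.2, density_snd]; exact hX
        · refine le_trans (le_of_eq ?_) hβ
          rw [density_prod', density_prod']
          exact expect_congr rfl fun v _ => density_fst fun u => A u ∧ B v ∧ R u v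
        · refine le_trans (le_of_eq ?_) hβ
          rw [density_prod', density_prod']
          exact expect_congr rfl fun v _ => density_snd fun u => A u ∧ B v ∧ R u v
    _ = _ := by ring

lemma density_crossing_not {R : V → V → Prop} (hR : ∀ u v, R u v → R v u) :
    (density fun x : V × V => ¬ B x.1 ∧ ¬ ¬ B x.2 ∧ R x.1 x.2) =
      density fun x : V × V => B x.1 ∧ ¬ B x.2 ∧ R x.1 x.2 := by
  rw [density_swap]
  exact density_congr fun x => ⟨fun hx => ⟨not_not.1 hx.2.1, hx.1, hR _ _ hx.2.2⟩,
    fun hx => ⟨hx.2.1, not_not.2 hx.1, hR _ _ hx.2.2⟩⟩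

lemma cutsAreCrossed_of_odd (ha : 1 ≤ a) (hab : a ≤ b) (hbc : b ≤ c)
    (h₁ : Nat.gcd (Nat.gcd a b) c = 1) (h₂ : Odd (Nat.gcd (b - a) (c - b))) {γ : ℝ} (hγ : 0 < γ) :
    CutsAreCrossed.{u} a b c (4 / 9 + γ) := by
  intro ε hε
  obtain ⟨N, hN, hval⟩ := exists_multisets hab hbc h₁ h₂
  obtain ⟨a, rfl⟩ : ∃ a', a = a' + 1 := ⟨a - 1, by omega⟩
  obtain ⟨k, hk⟩ : ∃ k, N * (a + 1 + (b + c)) = k + 1 :=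
    ⟨N * (a + 1 + (b + c)) - 1, (Nat.sub_add_cancel (Nat.mul_pos hN (by omega))).symm⟩
  obtain ⟨θ, hθ, hθ1, hθ2⟩ : ∃ θ : ℝ, 0 < θ ∧ θ ≤ ε * γ / 8 ∧ θ ≤ ε / 40 :=
    ⟨min (ε * γ / 8) (ε / 40), by positivity, min_le_left _ _, min_le_right _ _⟩
  set κ := (θ ^ ((a + 1) * b * c)) ^ N
  have hκ : 0 < κ := by positivity
  set κ' := κ / 2 ^ (k + 1)
  have hκ' : 0 < κ' := by positivity
  set ε₂ := κ' ^ 2 / (4 * (k + 1))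
  have hε₂ : 0 < ε₂ := by positivity
  obtain ⟨ζ, hζ, hζ1, hζ2⟩ : ∃ ζ : ℝ, 0 < ζ ∧ ζ ≤ 1 / 20 ∧ ζ ≤ ε * ε₂ / 12 :=
    ⟨min (1 / 20) (ε * ε₂ / 12), by positivity, min_le_left _ _, min_le_right _ _⟩
  set c₀ := (ζ * ζ ^ 2) ^ ((a + 1) * b * c)
  have hc₀ : 0 < c₀ := by positivity
  set K₀ := a + (b + c)
  set c₁ := κ' ^ 2 / 4 / ((k * K₀ : ℕ) + 1) * c₀ ^ k
  have hc₁ : 0 < c₁ := by positivity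
  set K₁ := k + k + k * K₀
  refine ⟨min (min (ε * ε₂ / 4) c₀) (min (κ' ^ 2 / 4) c₁), by positivity, max K₀ K₁, ?_⟩
  set β := min (min (ε * ε₂ / 4) c₀) (min (κ' ^ 2 / 4) c₁)
  intro V _ E hE hδ A hA hA'
  obtain ⟨v₀, -⟩ := exists_of_density_pos (hε.trans_le hA)
  have : Nonempty V := ⟨v₀⟩
  have hδ' : ∀ v, 4 / 9 ≤ density fun x : V × V => E v x.1 x.2 := fun v => by linarith [hδ v]
  set C := tileable E (a + 1) b c
  rcases le_or_gt (ε * ε₂ / 4)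
    (density fun x : V × V => A x.1 ∧ ¬ A x.2 ∧ Exch C c₀ K₀ {x.1} {x.2}) with hcr | hcr
  · exact ((min_le_left _ _).trans (min_le_left _ _)).trans (hcr.trans (density_mono fun x hx =>
      ⟨hx.1, hx.2.1, hx.2.2.mono ((min_le_left _ _).trans (min_le_right _ _)) (le_max_left _ _)⟩))
  have hR : ∀ u v, ¬ Exceptional E ζ u →
      2 * ζ ≤ (density fun x : V × V => E u x.1 x.2 ∧ E v x.1 x.2) → Exch C c₀ K₀ {u} {v} :=
    fun u v hu h => exch_of_not_exceptional hζ hu h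
  have hsame : ∀ B : V → Prop, (ε ≤ density fun v => ¬ B v) →
      (density fun x : V × V => B x.1 ∧ ¬ B x.2 ∧ Exch C c₀ K₀ {x.1} {x.2}) ≤ ε * ε₂ / 4 →
      (density fun x : V × V => B x.1 ∧ B x.2 ∧ ¬ Exch C c₀ K₀ {x.1} {x.2}) ≤ ε₂ := by
    intro B hB' hB
    have := density_not_exch_mul_le (A := B) (R := fun u v => Exch C c₀ K₀ {u} {v}) hE hζ hζ1 hδ'
      hR hB' hB
    refine le_of_mul_le_mul_right ?_ hε
    linarith
  have hcr' : (density fun x : V × V => ¬ A x.1 ∧ ¬ ¬ A x.2 ∧ Exch C c₀ K₀ {x.1} {x.2}) ≤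
      ε * ε₂ / 4 :=
    (density_crossing_not (R := fun u v => Exch C c₀ K₀ {u} {v})
      fun u v h => h.symm).trans_le hcr.le
  have hin := hsame A hA' hcr.le
  have hout := hsame (fun v => ¬ A v) (by simpa using hA) hcr'
  have hkε : k * (2 * ε₂) ≤ κ' ^ 2 / 2 := by
    have : ε₂ * (4 * (k + 1)) = κ' ^ 2 := div_mul_cancel₀ _ (by positivity)
    nlinarith
  -- the case in which edges with one vertex in `B` and two outside of `B` are frequent
  have key : ∀ B : V → Prop, ε ≤ density B → (ε ≤ density fun v => ¬ B v) →
      (density fun x : V × V => B x.1 ∧ B x.2 ∧ ¬ Exch C c₀ K₀ {x.1} {x.2}) ≤ ε₂ →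
      (density fun x : V × V => ¬ B x.1 ∧ ¬ B x.2 ∧ ¬ Exch C c₀ K₀ {x.1} {x.2}) ≤ ε₂ →
      θ ≤ typeDensity E B false false true →
      β ≤ density fun x : V × V => B x.1 ∧ ¬ B x.2 ∧ Exch C β (max K₀ K₁) {x.1} {x.2} := by
    intro B hB hB' hin hout ht
    have hb : 1 ≤ b := by omega
    have hc : 1 ≤ c := by omega
    obtain ⟨z, hz, hzv⟩ : ∃ z ∈ ({0, b + c, a + 1 + b + c} : Set ℕ),
        HasValue C B (θ ^ ((a + 1) * b * c)) (a + 1 + (b + c)) z := by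
      rcases le_typeDensity_of_four_ninths hE hε hγ hθ1 hδ hB hB' with h | h | h
      · exact ⟨0, by simp, by simpa using hasValue_of_typeDensity ha hb hc hθ h⟩
      · exact ⟨b + c, by simp, by simpa using hasValue_of_typeDensity ha hb hc hθ h⟩
      · exact ⟨a + 1 + b + c, by simp,
          by simpa [add_assoc] using hasValue_of_typeDensity ha hb hc hθ h⟩
    have hv : ∀ s ∈ ({a + 1, b, c, z} : Set ℕ),
        HasValue C B (θ ^ ((a + 1) * b * c)) (a + 1 + (b + c)) s := by
      have ht' := ht
      rw [← typeDensity_rotate hE] at ht'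
      have ht'' := ht'
      rw [← typeDensity_rotate hE] at ht''
      rintro s (rfl | rfl | rfl | rfl)
      · simpa using hasValue_of_typeDensity ha hb hc hθ ht'
      · simpa using hasValue_of_typeDensity ha hb hc hθ ht''
      · simpa using hasValue_of_typeDensity ha hb hc hθ ht
      · exact hzv
    have hle : ∀ s ∈ ({a + 1, b, c, z} : Set ℕ), s ≤ a + 1 + (b + c) := by
      rintro s (rfl | rfl | rfl | rfl)
      · omega
      · omega
      · omega
      · rcases hz with rfl | rfl | rfl <;> omega
    obtain ⟨P, Q, hP, hQ, hPc, hQc, hPQ⟩ := hval z hz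
    have hP' := hasValue_sum (by positivity) fun s hs => hv s (hP s hs)
    have hQ' := hasValue_sum (by positivity) fun s hs => hv s (hQ s hs)
    have hPs := Multiset.sum_le_card_nsmul P _ fun s hs => hle s (hP s hs)
    rw [hPc, smul_eq_mul, hk, hPQ] at hPs
    rw [hPc, hk, hPQ] at hP'
    rw [hQc, hk] at hQ'
    refine ((min_le_right _ _).trans (min_le_left _ _)).trans
      ((density_exch_of_hasValue (by omega) hκ hc₀ hP' hQ' hin hout hkε).trans
        (density_mono fun x hx => ⟨hx.1, hx.2.1, hx.2.2.mono ?_ (le_max_right _ _)⟩))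
    exact (min_le_right _ _).trans (min_le_right _ _)
  have hcross := lt_typeDensity_crossing hE hε hδ' hA hA'
  rcases le_or_gt θ (typeDensity E A false false true) with ht | ht
  · exact key A hA hA' hin hout ht
  · have h2 : θ ≤ typeDensity E (fun v => ¬ A v) false false true := by
      rw [typeDensity_not, Bool.not_false, Bool.not_true, typeDensity_rotate hE,
        typeDensity_rotate hE]
      linarith
    have h3 := key (fun v => ¬ A v) hA' (by simpa using hA) hout (by simpa using hin) h2
    exact h3.trans_eq (density_crossing_not
      (R := fun u v => Exch C β (max K₀ K₁) {u} {v}) fun u v h => h.symm)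

end OddCut

/-! ### From crossed cuts to exchangeable pairs -/

section Connectivity

/-- In every symmetric relation with link densities at least `δ`, almost all pairs of vertices are
exchangeable. -/
def MostPairsExch (a b c : ℕ) (δ : ℝ) : Prop :=
  ∀ ε : ℝ, 0 < ε → ∃ β : ℝ, 0 < β ∧ ∃ K : ℕ, ∀ (V : Type u) [Fintype V] (E : V → V → V → Prop),
    2 ≤ Fintype.card V → IsSymmetric E → (∀ v, δ ≤ density fun x : V × V => E v x.1 x.2) →
    (density fun x : V × V => ¬ Exch (tileable E a b c) β K {x.1} {x.2}) ≤ ε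

lemma density_mem_finset {V : Type*} [Fintype V] (S : Finset V) :
    density (fun v => v ∈ S) = #S / Fintype.card V := by
  classical
  rw [density, Fintype.expect_eq_sum_div_card]
  refine congrArg (· / (Fintype.card V : ℝ)) ?_
  trans ∑ v, if v ∈ S then (1 : ℝ) else 0
  · exact sum_congr rfl fun v _ => by congr
  · simp

/-- A set of density at least `ε` has a subset of density between `ε` and `1 - ε`. -/
lemma exists_subset_density {V : Type*} [Fintype V] (hV : 2 ≤ Fintype.card V) {ε : ℝ}
    (hε : 0 < ε) (hε' : ε ≤ 1 / 4) {D : V → Prop} (hD : ε ≤ density D) :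
    ∃ A : V → Prop, (∀ v, A v → D v) ∧ ε ≤ density A ∧ ε ≤ density fun v => ¬ A v := by
  classical
  have : Nonempty V := Fintype.card_pos_iff.1 (by omega)
  have hn : (2 : ℝ) ≤ Fintype.card V := by exact_mod_cast hV
  have h1 : density D = density fun v => v ∈ univ.filter D := density_congr fun v => by simp
  rw [h1, density_mem_finset, le_div_iff₀ (by linarith)] at hD
  obtain ⟨S, hS, hSc⟩ := exists_subset_card_eq (Nat.ceil_le.2 hD)
  have h2 := Nat.le_ceil (ε * Fintype.card V)
  have h3 := Nat.ceil_lt_add_one (a := ε * Fintype.card V) (by positivity)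
  rw [← hSc] at h2 h3
  refine ⟨fun v => v ∈ S, fun v hv => by simpa using hS hv, ?_, ?_⟩
  · rw [density_mem_finset, le_div_iff₀ (by linarith)]; exact h2
  · rw [density_not, density_mem_finset, le_sub_comm, div_le_iff₀ (by linarith)]
    nlinarith

variable {a b c : ℕ} {δ : ℝ}

/-- As long as the complement of the set reached from `u` is not small, the cut property yields a
positive proportion of further vertices that can be reached. -/
lemma exists_reached_set {ε η β₀ β₁ : ℝ} {K₀ K₁ : ℕ} (hβ₀ : 0 < β₀) (hβ₁ : 0 < β₁) (j : ℕ) :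
    ∃ β : ℝ, 0 < β ∧ ∃ K : ℕ, ∀ (V : Type u) [Fintype V] (E : V → V → V → Prop),
      (∀ A : V → Prop, ε ≤ density A → (η ≤ density fun v => ¬ A v) → β₁ ≤ density
        fun x : V × V => A x.1 ∧ ¬ A x.2 ∧ Exch (tileable E a b c) β₁ K₁ {x.1} {x.2}) →
      ∀ u : V, ε ≤ (density fun v => Exch (tileable E a b c) β₀ K₀ {u} {v}) →
      ∃ A : V → Prop, ε ≤ density A ∧
        ((density fun v => ¬ A v) < η ∨ j * (β₁ / 2) ≤ density A) ∧
        ∀ v, A v → Exch (tileable E a b c) β K {u} {v} := by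
  induction j with
  | zero =>
    refine ⟨β₀, hβ₀, K₀, fun V _ E _ u hu => ⟨_, hu, Or.inr ?_, fun v hv => hv⟩⟩
    simpa using density_nonneg _
  | succ j ih =>
    obtain ⟨β, hβ, K, ih⟩ := ih
    refine ⟨min β (β₁ / 2 / ((K + K₁ : ℕ) + 1) * (β * β₁)), by positivity, 1 + (K + K₁), ?_⟩
    intro V _ E hcut u hu
    obtain ⟨A, hA, hAj, hAe⟩ := ih V E hcut u hu
    by_cases hs : (density fun v => ¬ A v) < η
    · exact ⟨A, hA, Or.inl hs, fun v hv => (hAe v hv).mono (min_le_left _ _) (by omega)⟩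
    have h1 := hcut A hA (not_lt.1 hs)
    rw [density_swap] at h1
    have h2 := half_le_density_fiber h1
    set new : V → Prop := fun y => β₁ / 2 ≤ density fun x =>
      A x ∧ ¬ A y ∧ Exch (tileable E a b c) β₁ K₁ {x} {y}
    have hnew : ∀ y, new y → ¬ A y := fun y hy => by
      obtain ⟨x, hx⟩ := exists_of_density_pos ((half_pos hβ₁).trans_le hy)
      exact hx.2.1
    have h3 := density_or_add_and A new
    have h4 : (density fun y => A y ∧ new y) = 0 := by
      rw [← density_false (Ω := V)]
      exact density_congr fun y => ⟨fun h => hnew y h.2 h.1, False.elim⟩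
    have h5 : β₁ / 2 ≤ density new := h2
    refine ⟨fun y => A y ∨ new y, by linarith, Or.inr ?_, ?_⟩
    · have := hAj.resolve_left hs
      push_cast
      linarith
    · rintro v (hv | hv)
      · exact (hAe v hv).mono (min_le_left _ _) (by omega)
      · exact (exch_trans samples_singleton (half_pos hβ₁) hβ.le hβ₁.le (hv.trans (density_mono
          fun x hx => ⟨hAe x hx.1, hx.2.2⟩))).mono (min_le_right _ _) le_rfl

lemma CutsAreCrossed.mostPairsExch (h : CutsAreCrossed.{u} a b c δ) :
    MostPairsExch.{u} a b c δ := by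
  intro ε hε
  obtain ⟨ε₀, hε₀, hε₀1, hε₀2⟩ : ∃ ε₀ : ℝ, 0 < ε₀ ∧ ε₀ ≤ ε / 2 ∧ ε₀ ≤ 1 / 4 :=
    ⟨min (ε / 2) (1 / 4), by positivity, min_le_left _ _, min_le_right _ _⟩
  obtain ⟨β₀, hβ₀, K₀, h₀⟩ := h ε₀ hε₀
  obtain ⟨ε₁, hε₁, hε₁1, hε₁2⟩ : ∃ ε₁ : ℝ, 0 < ε₁ ∧ ε₁ ≤ ε₀ ∧ ε₁ ≤ β₀ / 2 :=
    ⟨min ε₀ (β₀ / 2), by positivity, min_le_left _ _, min_le_right _ _⟩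
  obtain ⟨β₁, hβ₁, K₁, h₁⟩ := h ε₁ hε₁
  obtain ⟨j, hj⟩ := exists_nat_gt (1 / (β₁ / 2))
  rw [div_lt_iff₀ (by positivity)] at hj
  obtain ⟨β, hβ, K, hr⟩ := exists_reached_set.{u} (a := a) (b := b) (c := c) (ε := ε₁) (η := ε₁)
    (K₀ := K₀) (K₁ := K₁) hβ₀ hβ₁ j
  refine ⟨β, hβ, K, fun V _ E hV hE hδ => ?_⟩
  set D : V → Prop := fun u =>
    (density fun v => Exch (tileable E a b c) β₀ K₀ {u} {v}) < β₀ / 2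
  have hD : density D ≤ ε₀ := by
    by_contra! hD
    obtain ⟨A, hAD, hA, hA'⟩ := exists_subset_density hV hε₀ hε₀2 hD.le
    have h2 := h₀ V E hE hδ A hA hA'
    have h3 := density_prod_le (p := A)
      (q := fun u v => ¬ A v ∧ Exch (tileable E a b c) β₀ K₀ {u} {v}) (c := β₀ / 2) fun u hu =>
      (density_mono fun v hv => hv.2).trans (hAD u hu).le
    nlinarith [density_le_one A]
  have h2 := density_le_add (p := fun x : V × V => ¬ Exch (tileable E a b c) β K {x.1} {x.2})
    (q := fun x => D x.1) (r := fun x => ¬ D x.1 ∧ ¬ Exch (tileable E a b c) β K {x.1} {x.2})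
    fun x hx => by tauto
  have : Nonempty V := Fintype.card_pos_iff.1 (by omega)
  rw [density_fst] at h2
  have h3 := density_prod_le (p := fun u => ¬ D u)
    (q := fun u v => ¬ Exch (tileable E a b c) β K {u} {v}) (c := ε₀) fun u hu => by
      obtain ⟨A, -, hAj, hAe⟩ := hr V E (h₁ V E hE hδ) u (hε₁2.trans (not_lt.1 hu))
      have h4 : (density fun v => ¬ A v) < ε₁ := by
        refine hAj.resolve_right fun h => ?_
        linarith [density_le_one A]
      exact ((density_mono fun v hv hA => hv (hAe v hA)).trans h4.le).trans hε₁1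
  nlinarith [density_le_one fun u => ¬ D u]

lemma mostPairsExch_of_half (ha : 1 ≤ a) {γ : ℝ} (hγ : 0 < γ) :
    MostPairsExch.{u} a b c (1 / 2 + γ) := by
  intro ε hε
  obtain ⟨a, rfl⟩ : ∃ a', a = a' + 1 := ⟨a - 1, by omega⟩
  obtain ⟨ζ, hζ, hζ1, hζ2⟩ : ∃ ζ : ℝ, 0 < ζ ∧ ζ ≤ γ ∧ ζ ≤ ε / 3 :=
    ⟨min γ (ε / 3), by positivity, min_le_left _ _, min_le_right _ _⟩
  refine ⟨(ζ * ζ ^ 2) ^ ((a + 1) * b * c), by positivity, a + (b + c), fun V _ E hV hE hδ => ?_⟩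
  have : Nonempty V := Fintype.card_pos_iff.1 (by omega)
  calc _ ≤ density (fun x : V × V => Exceptional E ζ x.1) := density_mono fun x hx => by
        by_contra h
        refine hx (exch_of_not_exceptional hζ h ?_)
        have h1 := density_or_add_and (fun y : V × V => E x.1 y.1 y.2) fun y => E x.2 y.1 y.2
        have h2 := density_le_one fun y : V × V => E x.1 y.1 y.2 ∨ E x.2 y.1 y.2
        linarith [hδ x.1, hδ x.2]
    _ ≤ 3 * ζ := by rw [density_fst]; exact density_exceptional_le hE hζ
    _ ≤ ε := by linarith

end Connectivity

/-! ### Absorbing tuples -/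

section Absorbers

variable {V : Type*}

lemma exists_tup_eq {n : ℕ} {T : Multiset V} (hT : T.card = n) : ∃ t : Fin n → V, tup t = T := by
  induction n generalizing T with
  | zero => exact ⟨Fin.elim0, by rw [Multiset.card_eq_zero.1 hT]; simp [tup]⟩
  | succ n ih =>
    obtain ⟨v, T', rfl⟩ := Multiset.card_pos_iff_exists_mem.1 (by omega : 0 < T.card) |>.imp
      fun v hv => Multiset.exists_cons_of_mem hv
    obtain ⟨t, rfl⟩ := ih (T := T') (by simpa using hT)
    exact ⟨Fin.cons v t, by simp [tup, Fin.sum_univ_succ]⟩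

variable [Fintype V] {C : AddSubmonoid (Multiset V)}

lemma pow_le_density_tup_mem {κ : ℝ} {m : ℕ} (hκ : 0 ≤ κ)
    (h : κ ≤ density fun s : Fin m → V => tup s ∈ C) (n : ℕ) :
    κ ^ n ≤ density fun s : Fin (n * m) → V => tup s ∈ C := by
  induction n with
  | zero =>
    have h1 := ((samples_fin (V := V) 0).cast (Nat.zero_mul m).symm) fun M => M ∈ C
    rw [← h1]
    simp [tup, C.zero_mem, density_true]
  | succ n ih =>
    have h1 := (((samples_fin (V := V) (n * m)).prod (samples_fin m)).cast (Nat.succ_mul n m).symm)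
      fun M => M ∈ C
    rw [← h1, pow_succ]
    refine (mul_le_mul ih h hκ (density_nonneg _)).trans ?_
    rw [← density_and_prod]
    exact density_mono fun x hx => C.add_mem hx.1 hx.2

lemma le_density_tup_mem [Nonempty V] {κ : ℝ} {l : ℕ}
    (hC : ∀ v : V, κ ≤ density fun s : Fin l → V => {v} + tup s ∈ C) :
    κ ≤ density fun s : Fin (l + 1) → V => tup s ∈ C := by
  have h1 := ((samples_singleton (V := V)).prod (samples_fin l)).cast (add_comm 1 l)
    fun M => M ∈ C
  rw [← h1, density_prod]
  exact le_expect univ_nonempty fun v _ => hC v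

/-- If almost all pairs of vertices are exchangeable and every vertex is in many elements of `C` of
size `l + 1`, then many tuples absorb a given multiset `T` of size `l + 1`: each element of `T` is
put into an element of `C` together with `l` random partners, and the partners are exchangeable
with the vertices of `l` random elements of `C`. -/
lemma exch_zero_of_most {l K : ℕ} {κ β ε : ℝ} (hκ : 0 < κ) (hβ : 0 < β)
    (hC : ∀ v : V, κ ≤ density fun s : Fin l → V => {v} + tup s ∈ C)
    (hC' : κ ≤ density fun s : Fin (l + 1) → V => tup s ∈ C)
    (hex : (density fun x : V × V => ¬ Exch C β K {x.1} {x.2}) ≤ ε)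
    (hε : ((l + 1) * l : ℕ) * ε ≤ κ ^ (l + 1) * κ ^ l / 2) {T : Multiset V} (hT : T.card = l + 1) :
    Exch C (κ ^ (l + 1) * κ ^ l / 2 / (((l + 1) * l * K : ℕ) + 1) * β ^ ((l + 1) * l))
      ((l + 1) * l + (l + 1) * l + (l + 1) * l * K) T 0 := by
  obtain ⟨t, rfl⟩ := exists_tup_eq hT
  have : Nonempty V := ⟨t 0⟩
  have h1 : κ ^ (l + 1) ≤ density fun P : Fin (l + 1) × Fin l → V => tup t + tup P ∈ C := by
    rw [← density_equiv (Equiv.curry (Fin (l + 1)) (Fin l) V).symm]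
    calc κ ^ (l + 1) = ∏ _i : Fin (l + 1), κ := by simp
      _ ≤ ∏ i, density fun s : Fin l → V => {t i} + tup s ∈ C :=
          prod_le_prod (fun _ _ => hκ.le) fun i _ => hC (t i)
      _ = _ := (density_pi fun i (s : Fin l → V) => {t i} + tup s ∈ C).symm
      _ ≤ _ := density_mono fun P hP => by
          have h2 : tup t + tup ((Equiv.curry (Fin (l + 1)) (Fin l) V).symm P) =
              ∑ i, ({t i} + tup (P i)) := by
            simp only [tup, sum_add_distrib, Fintype.sum_prod_type]
            rfl
          rw [h2]
          exact C.sum_mem fun i _ => hP i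
  have h2 : κ ^ l ≤ density fun R : Fin (l + 1) × Fin l → V => 0 + tup R ∈ C := by
    have h3 := (samples_tup (V := V) (ι := Fin (l + 1) × Fin l)).cast
      (by simp [mul_comm] : _ = l * (l + 1)) fun M => 0 + M ∈ C
    rw [h3]
    simpa using pow_le_density_tup_mem hκ.le hC' l
  have h3 : κ ^ (l + 1) * κ ^ l ≤ density fun x : (Fin (l + 1) × Fin l → V) ×
      (Fin (l + 1) × Fin l → V) => tup t + tup x.1 ∈ C ∧ 0 + tup x.2 ∈ C := by
    rw [density_and_prod (fun P : Fin (l + 1) × Fin l → V => tup t + tup P ∈ C)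
      fun R : Fin (l + 1) × Fin l → V => 0 + tup R ∈ C]
    exact mul_le_mul h1 h2 (by positivity) (density_nonneg _)
  rw [density_split _ fun x => ∀ i, Exch C β K {x.1 i} {x.2 i}] at h3
  have h4 : (density fun x : (Fin (l + 1) × Fin l → V) × (Fin (l + 1) × Fin l → V) =>
      (tup t + tup x.1 ∈ C ∧ 0 + tup x.2 ∈ C) ∧ ¬ ∀ i, Exch C β K {x.1 i} {x.2 i}) ≤
      ((l + 1) * l : ℕ) * ε := by
    refine (density_sum_le (univ : Finset (Fin (l + 1) × Fin l)) (q := fun i x =>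
      ¬ Exch C β K {x.1 i} {x.2 i}) fun x hx => by simpa using hx.2).trans ?_
    calc _ ≤ ∑ _i : Fin (l + 1) × Fin l, ε := sum_le_sum fun i _ =>
          (density_apply_apply i i fun u v => ¬ Exch C β K {u} {v}).trans_le hex
      _ = _ := by simp
  have h5 : κ ^ (l + 1) * κ ^ l / 2 ≤ density fun x : (Fin (l + 1) × Fin l → V) ×
      (Fin (l + 1) × Fin l → V) => (tup t + tup x.1 ∈ C ∧ 0 + tup x.2 ∈ C) ∧
        ∀ i, Exch C β K {x.1 i} {x.2 i} := by linarith
  have h6 := exch_of_paired (by positivity) hβ.le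
    (h5.trans_eq (density_congr fun x => and_assoc))
  rw [Fintype.card_prod, Fintype.card_fin, Fintype.card_fin] at h6
  exact h6

/-- All absorbing tuples can be taken of the same length, by adding elements of `C`. -/
lemma density_absorbing {K m : ℕ} {κ β : ℝ} (hβ : 0 < β) (hκ : 0 < κ) (hκ1 : κ ≤ 1)
    (hdvd : ∀ M ∈ C, m ∣ M.card) (hm : 1 ≤ m)
    (hC : κ ≤ density fun s : Fin m → V => tup s ∈ C) {T : Multiset V} (h : Exch C β K T 0) :
    β * κ ^ (K + 1) ≤
      density fun s : Fin ((K + 1) * m) → V => tup s ∈ C ∧ T + tup s ∈ C := by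
  obtain ⟨k, hk, hd⟩ := h
  obtain ⟨s, hs⟩ := exists_of_density_pos (hβ.trans_le hd)
  obtain ⟨j, rfl⟩ : m ∣ k := by simpa [card_tup] using hdvd _ hs.2
  have hj : j ≤ K := (Nat.le_mul_of_pos_left j hm).trans hk
  have h2 : m * j + (K + 1 - j) * m = (K + 1) * m := by
    rw [mul_comm m j, ← add_mul]
    congr 1
    omega
  have h1 := ((samples_fin (V := V) (m * j)).prod (samples_fin ((K + 1 - j) * m))).cast h2
    fun M => M ∈ C ∧ T + M ∈ C
  rw [← h1]
  have h3 := pow_le_density_tup_mem hκ.le hC (K + 1 - j)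
  calc β * κ ^ (K + 1) ≤ β * κ ^ (K + 1 - j) := mul_le_mul_of_nonneg_left
        (pow_le_pow_of_le_one hκ.le hκ1 (by omega)) hβ.le
    _ ≤ _ := mul_le_mul hd h3 (by positivity) (density_nonneg _)
    _ = _ := (density_and_prod _ _).symm
    _ ≤ _ := density_mono fun x hx => ⟨?_, ?_⟩
  · exact C.add_mem (by simpa using hx.1.2) hx.2
  · rw [← add_assoc]
    exact C.add_mem hx.1.1 hx.2

lemma MostPairsExch.absorbing {a b c : ℕ} (ha : 1 ≤ a) {δ κ : ℝ} (hκ : 0 < κ)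
    (h : MostPairsExch.{u} a b c δ)
    (hblock : ∀ (V : Type u) [Fintype V] (E : V → V → V → Prop), IsSymmetric E →
      (∀ v, δ ≤ density fun x : V × V => E v x.1 x.2) → ∀ v : V,
      κ ≤ density fun s : Fin (a - 1 + (b + c)) → V => {v} + tup s ∈ tileable E a b c) :
    ∃ β : ℝ, 0 < β ∧ ∃ k : ℕ, 1 ≤ k ∧ ∀ (V : Type u) [Fintype V] (E : V → V → V → Prop),
      2 ≤ Fintype.card V → IsSymmetric E → (∀ v, δ ≤ density fun x : V × V => E v x.1 x.2) →
      ∀ T : Multiset V, T.card = a + b + c → β ≤ density fun s : Fin k → V =>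
        tup s ∈ tileable E a b c ∧ T + tup s ∈ tileable E a b c := by
  obtain ⟨l, hl', hl⟩ : ∃ l, a - 1 + (b + c) = l ∧ l + 1 = a + b + c := ⟨_, rfl, by omega⟩
  rw [hl'] at hblock
  obtain ⟨β, hβ, K, h⟩ := h (κ ^ (l + 1) * κ ^ l / 2 / (((l + 1) * l : ℕ) + 1)) (by positivity)
  set β' := κ ^ (l + 1) * κ ^ l / 2 / (((l + 1) * l * K : ℕ) + 1) * β ^ ((l + 1) * l)
  set K' := (l + 1) * l + (l + 1) * l + (l + 1) * l * K
  refine ⟨β' * κ ^ (K' + 1), by positivity, (K' + 1) * (l + 1), Nat.mul_pos (by omega) (by omega),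
    ?_⟩
  intro V _ E hV hE hδ T hT
  have : Nonempty V := Fintype.card_pos_iff.1 (by omega)
  obtain ⟨v₀⟩ := this
  have : Nonempty V := ⟨v₀⟩
  have hC := hblock V E hE hδ
  have hC' := le_density_tup_mem hC
  have hκ1 : κ ≤ 1 := (hC v₀).trans (density_le_one _)
  have hε : ((l + 1) * l : ℕ) * (κ ^ (l + 1) * κ ^ l / 2 / (((l + 1) * l : ℕ) + 1)) ≤
      κ ^ (l + 1) * κ ^ l / 2 := by
    rw [mul_div_assoc', div_le_iff₀ (by positivity), mul_comm]
    exact mul_le_mul_of_nonneg_left (by simp) (by positivity)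
  have hex := exch_zero_of_most hκ hβ hC hC' (h V E hV hE hδ) hε (hT.trans hl.symm)
  exact density_absorbing (by positivity) hκ hκ1
    (fun M hM => hl ▸ dvd_card_of_mem_tileable hM) (by omega) hC' hex

end Absorbers

/-! ### Choosing the absorbing set -/

section AbsorbingFamily

lemma tup_eq_map {V ι : Type*} [Fintype ι] (s : ι → V) : tup s = univ.val.map s := by
  rw [tup, Finset.sum, ← Multiset.sum_map_singleton (univ.val.map s), Multiset.map_map]
  rfl

lemma val_biUnion_eq_sum {V : Type*} [DecidableEq V] {𝓕 : Finset (Finset V)}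
    (h : (𝓕 : Set (Finset V)).PairwiseDisjoint id) : (𝓕.biUnion id).val = ∑ S ∈ 𝓕, S.val := by
  induction 𝓕 using Finset.induction_on with
  | empty => simp
  | insert S 𝓕 hS ih =>
    rw [coe_insert, Set.pairwiseDisjoint_insert] at h
    have h1 : Disjoint S (𝓕.biUnion id) := (disjoint_biUnion_right _ _ _).2 fun S' hS' =>
      h.2 S' hS' fun h => hS (h ▸ hS')
    rw [sum_insert hS, ← ih h.1, biUnion_insert, id, ← disjUnion_eq_union _ _ h1]
    rfl

variable {V : Type*} {C : AddSubmonoid (Multiset V)}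

/-- The set `S` absorbs the tuple `T`: `S` belongs to `C`, with and without `T`. -/
def IsAbsorber (C : AddSubmonoid (Multiset V)) {m : ℕ} (S : Finset V) (T : Fin m → V) : Prop :=
  S.val ∈ C ∧ tup T + S.val ∈ C

open Classical in
/-- The number of members of the family `𝓕` that absorb `T`. -/
noncomputable def hits (C : AddSubmonoid (Multiset V)) {m : ℕ} (𝓕 : Finset (Finset V))
    (T : Fin m → V) : ℕ :=
  #(𝓕.filter fun S => IsAbsorber C S T)

/-- A family with at least `r` absorbers for each `m`-tuple absorbs each multiset of size
`r * m`. -/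
lemma sum_add_mem_of_le_hits {m r : ℕ} {𝓖 : Finset (Finset V)} (h𝓖 : ∀ S ∈ 𝓖, S.val ∈ C)
    (h : ∀ T : Fin m → V, r ≤ hits C 𝓖 T) {U : Multiset V} (hU : U.card = r * m) :
    ∑ S ∈ 𝓖, S.val + U ∈ C := by
  classical
  induction r generalizing 𝓖 U with
  | zero =>
    rw [Multiset.card_eq_zero.1 (hU.trans (Nat.zero_mul m)), add_zero]
    exact C.sum_mem h𝓖
  | succ r ih =>
    obtain ⟨U', T, rfl, hU', hT⟩ := exists_add_of_card_eq_add (hU.trans (Nat.succ_mul r m))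
    obtain ⟨t, rfl⟩ := exists_tup_eq hT
    have h1 : 0 < hits C 𝓖 t := (Nat.succ_pos r).trans_le (h t)
    obtain ⟨S, hS⟩ := card_pos.1 h1
    rw [mem_filter] at hS
    have h2 := ih (𝓖 := 𝓖.erase S) (fun S' hS' => h𝓖 S' (mem_of_mem_erase hS')) (fun T => by
      have h3 := h T
      have h4 : hits C 𝓖 T ≤ hits C (𝓖.erase S) T + 1 := by
        rw [hits, hits, filter_erase]
        exact Nat.le_add_of_sub_le (pred_card_le_card_erase)
      omega) hU'
    rw [← add_sum_erase _ _ hS.1, show S.val + ∑ S ∈ 𝓖.erase S, S.val + (U' + tup t) =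
      ∑ S ∈ 𝓖.erase S, S.val + U' + (tup t + S.val) by abel]
    exact C.add_mem h2 hS.2.2

variable [Fintype V]

lemma density_eq_le {v : V} : density (fun x : V => x = v) ≤ 1 / Fintype.card V := by
  rw [density_congr (q := fun x => x ∈ ({v} : Finset V)) fun x => by simp, density_mem_finset]
  simp

lemma density_apply_eq_apply_le {k : ℕ} {i j : Fin k} (hij : i ≠ j) :
    (density fun s : Fin k → V => s i = s j) ≤ 1 / Fintype.card V := by
  rcases isEmpty_or_nonempty V with hV | hV
  · have : IsEmpty (Fin k → V) := ⟨fun s => hV.false (s i)⟩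
    simp [density]
  have hn : (0 : ℝ) < Fintype.card V := by exact_mod_cast Fintype.card_pos
  calc _ ≤ ∑ v : V, density fun s : Fin k → V => ∀ l, (l = i ∨ l = j) → s l = v :=
        density_sum_le univ fun s hs =>
          ⟨s i, mem_univ _, by rintro l (rfl | rfl); exacts [rfl, hs.symm]⟩
    _ ≤ ∑ _v : V, (1 / Fintype.card V : ℝ) ^ 2 := sum_le_sum fun v _ => by
        rw [density_pi fun l x => (l = i ∨ l = j) → x = v]
        rw [← prod_subset (subset_univ {i, j}) fun l _ hl => ?_, prod_pair hij, sq]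
        · exact mul_le_mul (by simpa using density_eq_le) (by simpa using density_eq_le)
            (density_nonneg _) (by positivity)
        · simp only [mem_insert, mem_singleton] at hl
          simp [hl, density_true]
    _ = _ := by
        rw [sum_const, card_univ, nsmul_eq_mul]
        field_simp

/-- Few tuples have a repeated entry or an entry in a given small set. -/
lemma density_not_nodup_or_mem_le [Nonempty V] (k : ℕ) (W : Finset V) :
    (density fun s : Fin k → V => ¬ (tup s).Nodup ∨ ∃ v ∈ tup s, v ∈ W) ≤
      (k * k + k * #W) / Fintype.card V := by
  classical
  have hn : (0 : ℝ) < Fintype.card V := by exact_mod_cast Fintype.card_pos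
  refine (density_or_le _ _).trans ?_
  rw [add_div]
  refine add_le_add ?_ ?_
  · calc _ ≤ ∑ x ∈ (univ : Finset (Fin k × Fin k)).filter fun x => x.1 ≠ x.2,
            density fun s : Fin k → V => s x.1 = s x.2 := by
          refine density_sum_le _ fun s hs => ?_
          by_contra! h
          refine hs ?_
          rw [tup_eq_map]
          refine Multiset.Nodup.map (fun i j hij => ?_) univ.nodup
          by_contra hne
          exact h (i, j) (by simpa using hne) hij
      _ ≤ ∑ x ∈ (univ : Finset (Fin k × Fin k)).filter fun x => x.1 ≠ x.2,
            (1 / Fintype.card V : ℝ) :=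
          sum_le_sum fun x hx => density_apply_eq_apply_le (by simpa using hx)
      _ ≤ ∑ _x : Fin k × Fin k, (1 / Fintype.card V : ℝ) :=
          sum_le_sum_of_subset_of_nonneg (filter_subset _ _) fun _ _ _ => by positivity
      _ = _ := by simp [div_eq_mul_inv]
  · calc _ ≤ ∑ i : Fin k, density fun s : Fin k → V => s i ∈ W := by
          refine density_sum_le _ fun s hs => ?_
          obtain ⟨v, hv, hvW⟩ := hs
          obtain ⟨i, rfl⟩ := mem_tup.1 hv
          exact ⟨i, mem_univ i, hvW⟩
      _ = _ := by
          simp only [density_apply _ fun v => v ∈ W, density_mem_finset]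
          simp [mul_div_assoc]

/-- If every `m`-tuple is absorbed by many `k`-tuples, then there is a family of `N` disjoint
`k`-sets for which the weight `(1 / 2) ^ hits` is exponentially small on average. The sets are
chosen one by one, each of them absorbing an `m`-tuple of at least average weight. -/
lemma exists_absorbing_family [Nonempty V] {k m : ℕ} {β : ℝ} (hβ : 0 < β) (hβ1 : β ≤ 1) (hk : 1 ≤ k)
    (h : ∀ T : Fin m → V, β ≤ density fun s : Fin k → V => tup s ∈ C ∧ tup T + tup s ∈ C) (N : ℕ)
    (hN : (k * k + k * (k * N : ℕ)) / Fintype.card V ≤ β / 2) :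
    ∃ 𝓕 : Finset (Finset V), #𝓕 = N ∧ (∀ S ∈ 𝓕, #S = k ∧ S.val ∈ C) ∧
      (𝓕 : Set (Finset V)).PairwiseDisjoint id ∧
      (𝔼 T : Fin m → V, (1 / 2 : ℝ) ^ hits C 𝓕 T) ≤ (1 - β / 4) ^ N := by
  classical
  have hn : (0 : ℝ) < Fintype.card V := by exact_mod_cast Fintype.card_pos
  induction N with
  | zero => exact ⟨∅, by simp, by simp, by simp, by simp [hits]⟩
  | succ N ih =>
    obtain ⟨𝓕, hc, hS, hd, hw⟩ := ih (le_trans (by gcongr; omega) hN)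
    set W := 𝓕.biUnion id
    have hW : #W ≤ k * N := by
      rw [mul_comm, ← hc]
      exact card_biUnion_le_card_mul _ _ _ fun S hS' => (hS S hS').1.le
    set bad : (Fin k → V) → Prop := fun s => ¬ (tup s).Nodup ∨ ∃ v ∈ tup s, v ∈ W
    have hbad : density bad ≤ β / 2 := by
      refine (density_not_nodup_or_mem_le k W).trans (le_trans ?_ hN)
      gcongr
      exact hW.trans (Nat.mul_le_mul_left k (Nat.le_succ N))
    set good : (Fin m → V) → (Fin k → V) → Prop := fun T s =>
      (tup s ∈ C ∧ tup T + tup s ∈ C) ∧ ¬ bad s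
    have hgood : ∀ T, β / 2 ≤ density (good T) := fun T => by
      have h1 := density_le_add (p := fun s : Fin k → V => tup s ∈ C ∧ tup T + tup s ∈ C)
        (q := good T) (r := bad) fun s hs => by
          by_cases hb : bad s
          · exact Or.inr hb
          · exact Or.inl ⟨hs, hb⟩
      linarith [h T]
    set w : (Fin m → V) → ℝ := fun T => (1 / 2 : ℝ) ^ hits C 𝓕 T
    have hw0 : ∀ T, 0 < w T := fun T => by positivity
    obtain ⟨s, -, hs⟩ : ∃ s ∈ (univ : Finset (Fin k → V)),
        β / 2 * (𝔼 T, w T) ≤ 𝔼 T, w T * (if good T s then 1 else 0) := by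
      refine exists_le_of_le_expect univ_nonempty ?_
      rw [expect_comm, mul_expect]
      refine expect_le_expect fun T _ => ?_
      rw [← mul_expect, mul_comm]
      refine (mul_le_mul_of_nonneg_left (hgood T) (hw0 T).le).trans_eq ?_
      rw [density]
      congr!
    obtain ⟨T₀, hT₀⟩ : ∃ T, good T s := by
      by_contra! hcon
      simp only [hcon, if_false, mul_zero, expect_const_zero] at hs
      have : 0 < 𝔼 T, w T := expect_pos (fun T _ => hw0 T) univ_nonempty
      nlinarith
    have hnd : (tup s).Nodup := by_contra fun h => hT₀.2 (Or.inl h)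
    have hdis : ∀ v ∈ tup s, v ∉ W := fun v hv hvW => hT₀.2 (Or.inr ⟨v, hv, hvW⟩)
    let S : Finset V := ⟨tup s, hnd⟩
    have hSk : #S = k := by simp [S, card_tup]
    have hSF : S ∉ 𝓕 := fun hSF => by
      obtain ⟨v, hv⟩ := card_pos.1 (hk.trans_eq hSk.symm)
      exact hdis v hv (mem_biUnion.2 ⟨S, hSF, hv⟩)
    refine ⟨insert S 𝓕, by rw [card_insert_of_notMem hSF, hc], ?_, ?_, ?_⟩
    · intro S' hS'
      rcases mem_insert.1 hS' with rfl | hS'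
      · exact ⟨hSk, hT₀.1.1⟩
      · exact hS S' hS'
    · rw [coe_insert]
      refine hd.insert fun S' hS' _ => ?_
      exact disjoint_left.2 fun v hv hv' => hdis v hv (mem_biUnion.2 ⟨S', hS', hv'⟩)
    · have h1 : ∀ T, (1 / 2 : ℝ) ^ hits C (insert S 𝓕) T ≤
          w T - 1 / 2 * (w T * if good T s then 1 else 0) := fun T => by
        by_cases hg : good T s
        · have h2 : hits C (insert S 𝓕) T = hits C 𝓕 T + 1 := by
            rw [hits, filter_insert, if_pos (show IsAbsorber C S T from hg.1), card_insert_of_notMem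
              fun h => hSF (mem_filter.1 h).1, hits]
          rw [h2, pow_succ, if_pos hg]
          simp only [w]
          linarith
        · rw [if_neg hg, mul_zero, mul_zero, sub_zero]
          refine pow_le_pow_of_le_one (by norm_num) (by norm_num) ?_
          exact card_le_card (filter_subset_filter _ (subset_insert _ _))
      refine (expect_le_expect fun T _ => h1 T).trans ?_
      rw [expect_sub_distrib, ← mul_expect, pow_succ]
      have h3 : (𝔼 T, w T) * (1 - β / 4) ≤ (1 - β / 4) ^ N * (1 - β / 4) :=
        mul_le_mul_of_nonneg_right hw (by linarith)
      linarith

/-- Exponential decay beats polynomial growth, in the form needed for absorbing families. -/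
lemma exists_forall_lt {q : ℝ} (hq : 0 < q) (hq1 : q < 1) (D m : ℕ) :
    ∃ N₀ : ℕ, ∀ N ≥ N₀, ((D * (N + 1) : ℕ) : ℝ) ^ m * q ^ N < 1 := by
  have h1 := (tendsto_pow_const_mul_const_pow_of_abs_lt_one m
    (show |q| < 1 by rwa [abs_of_pos hq])).comp (Filter.tendsto_add_atTop_nat 1)
  have h2 := h1.const_mul ((D : ℝ) ^ m / q)
  rw [mul_zero] at h2
  obtain ⟨N₀, hN₀⟩ := Filter.eventually_atTop.1 (h2.eventually_lt_const zero_lt_one)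
  refine ⟨N₀, fun N hN => (le_of_eq ?_).trans_lt (hN₀ N hN)⟩
  simp only [Function.comp]
  push_cast
  rw [pow_succ, mul_pow]
  field_simp

lemma exists_absorbing_set {k m : ℕ} (hk : 1 ≤ k) (hm : 1 ≤ m) {β τ : ℝ} (hβ : 0 < β) (hτ : 0 < τ) :
    ∃ α : ℝ, 0 < α ∧ ∃ n₀ : ℕ, ∀ (V : Type u) [Fintype V] (C : AddSubmonoid (Multiset V)),
      n₀ ≤ Fintype.card V →
      (∀ T : Multiset V, T.card = m →
        β ≤ density fun s : Fin k → V => tup s ∈ C ∧ T + tup s ∈ C) →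
      ∃ W : Finset V, #W ≤ τ * Fintype.card V ∧ W.val ∈ C ∧
        ∀ U : Finset V, #U ≤ α * Fintype.card V → m ∣ #U → W.val + U.val ∈ C := by
  wlog hβ1 : β ≤ 1 generalizing β
  · obtain ⟨α, hα, n₀, h⟩ := this (β := 1) one_pos le_rfl
    exact ⟨α, hα, n₀, fun V _ C hn hT => h V C hn fun T hTm =>
      (not_le.1 hβ1).le.trans (hT T hTm)⟩
  set q := 1 - β / 4
  have hq : 0 < q := by simp only [q]; linarith
  have hq1 : q < 1 := by simp only [q]; linarith
  obtain ⟨L, hL⟩ := exists_pow_lt_of_lt_one (show (0 : ℝ) < 1 / 4 by norm_num) hq1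
  have hL0 : 0 < L := Nat.pos_of_ne_zero fun h => by subst h; norm_num at hL
  obtain ⟨D, hD⟩ := exists_nat_gt (max (k / τ) (4 * (k * k) / β))
  have hD1 := (le_max_left _ _).trans_lt hD
  have hD2 := (le_max_right _ _).trans_lt hD
  have hD0 : 0 < (D : ℝ) := lt_of_le_of_lt (by positivity) hD1
  have hD0' : 0 < D := by exact_mod_cast hD0
  rw [div_lt_iff₀ hτ] at hD1
  rw [div_lt_iff₀ hβ] at hD2
  obtain ⟨N₀, hN₀⟩ := exists_forall_lt hq hq1 D (m * 2)
  have hL0' : (0 : ℝ) < L := by exact_mod_cast hL0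
  obtain ⟨n₁, hn₁⟩ := exists_nat_gt (4 * (k * k) / β)
  rw [div_lt_iff₀ hβ] at hn₁
  refine ⟨1 / (D * L), by positivity, max (max 1 (D * N₀)) n₁, ?_⟩
  intro V _ C hn hT
  classical
  have hn1 : 1 ≤ Fintype.card V := (le_max_left _ _).trans ((le_max_left _ _).trans hn)
  have hnN : D * N₀ ≤ Fintype.card V := (le_max_right _ _).trans ((le_max_left _ _).trans hn)
  have hnn₁ : (n₁ : ℝ) ≤ Fintype.card V := by exact_mod_cast (le_max_right _ _).trans hn
  have : Nonempty V := Fintype.card_pos_iff.1 hn1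
  set n := Fintype.card V
  have hn0 : (0 : ℝ) < n := by exact_mod_cast hn1
  set N := n / D
  have hN : N₀ ≤ N := (Nat.le_div_iff_mul_le hD0').2 (by rwa [mul_comm])
  have hND : (N : ℝ) * D ≤ n := by exact_mod_cast Nat.div_mul_le_self n D
  have hnD : n < D * (N + 1) := Nat.lt_mul_div_succ n hD0'
  obtain ⟨𝓕, hc, hS, hd, hw⟩ := exists_absorbing_family (C := C) (m := m) hβ hβ1 hk
    (fun T => hT (tup T) (by simp [card_tup])) N (by
      rw [div_le_iff₀ hn0]
      push_cast
      have h1 : (k : ℝ) * (k * N) ≤ β / 4 * n := by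
        have h2 : 4 * (k * k : ℝ) * N ≤ D * β * N := by gcongr
        nlinarith
      have h3 : (k : ℝ) * k ≤ β / 4 * n := by nlinarith
      linarith)
  refine ⟨𝓕.biUnion id, ?_, ?_, ?_⟩
  · have h1 : #(𝓕.biUnion id) ≤ N * k := by
      rw [← hc]
      exact card_biUnion_le_card_mul _ _ _ fun S hS' => (hS S hS').1.le
    calc (#(𝓕.biUnion id) : ℝ) ≤ N * k := by exact_mod_cast h1
      _ ≤ N * (D * τ) := by gcongr
      _ ≤ τ * n := by nlinarith
  · rw [val_biUnion_eq_sum hd]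
    exact C.sum_mem fun S hS' => (hS S hS').2
  · rintro U hU ⟨r, hr⟩
    rw [val_biUnion_eq_sum hd]
    refine sum_add_mem_of_le_hits (m := m) (r := r) (fun S hS' => (hS S hS').2) (fun T => ?_)
      (by rw [mul_comm]; exact hr)
    by_contra! hlt
    set x := hits C 𝓕 T
    have hrU : r ≤ #U := by rw [hr]; exact Nat.le_mul_of_pos_left r hm
    have hxL : x * L ≤ N := by
      have h1 : (x : ℝ) ≤ 1 / (D * L) * n := le_trans (by exact_mod_cast hlt.le.trans hrU) hU
      rw [div_mul_eq_mul_div, one_mul, le_div_iff₀ (by positivity)] at h1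
      rw [Nat.le_div_iff_mul_le hD0']
      have h2 : x * (D * L) ≤ n := by exact_mod_cast h1
      calc x * L * D = x * (D * L) := by ring
        _ ≤ n := h2
    have h1 : (1 / 2 : ℝ) ^ x ≤ (n : ℝ) ^ m * q ^ N := by
      have h2 : (1 / 2 : ℝ) ^ x ≤ ∑ T : Fin m → V, (1 / 2 : ℝ) ^ hits C 𝓕 T :=
        single_le_sum (f := fun T : Fin m → V => (1 / 2 : ℝ) ^ hits C 𝓕 T)
          (fun T _ => by positivity) (mem_univ T)
      rw [Fintype.expect_eq_sum_div_card, div_le_iff₀ (by exact_mod_cast Fintype.card_pos)] at hw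
      simp only [Fintype.card_fun, Fintype.card_fin, Nat.cast_pow] at hw
      linarith
    have h2 : q ^ N ≤ (1 / 4 : ℝ) ^ x := by
      calc q ^ N ≤ q ^ (x * L) := pow_le_pow_of_le_one hq.le hq1.le hxL
        _ = (q ^ L) ^ x := by rw [mul_comm, pow_mul]
        _ ≤ _ := pow_le_pow_left₀ (by positivity) hL.le x
    have h3 : (1 / 4 : ℝ) ^ x = ((1 / 2 : ℝ) ^ x) ^ 2 := by
      rw [← pow_mul, mul_comm, pow_mul]; norm_num
    have h4 : ((1 / 2 : ℝ) ^ x) ^ 2 ≤ ((n : ℝ) ^ m * q ^ N) ^ 2 :=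
      pow_le_pow_left₀ (by positivity) h1 2
    have h5 : (n : ℝ) ^ (m * 2) ≤ ((D * (N + 1) : ℕ) : ℝ) ^ (m * 2) :=
      pow_le_pow_left₀ hn0.le (by exact_mod_cast hnD.le) _
    have h6 := hN₀ N hN
    have h7 : 0 < q ^ N := by positivity
    have h8 : q ^ N * 1 ≤ q ^ N * ((n : ℝ) ^ (m * 2) * q ^ N) := by
      calc q ^ N * 1 ≤ ((n : ℝ) ^ m * q ^ N) ^ 2 := by rw [mul_one]; linarith
        _ = _ := by rw [pow_mul]; ring
    have h9 := le_of_mul_le_mul_left h8 h7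
    nlinarith

end AbsorbingFamily

/-! ### Hypergraphs -/

section Hypergraph

lemma injective_of_nodup_tup {V ι : Type*} [Fintype ι] {s : ι → V} (h : (tup s).Nodup) :
    Function.Injective s := by
  rw [tup_eq_map] at h
  exact fun i j hij => Multiset.inj_on_of_nodup_map h i (mem_univ i) j (mem_univ j) hij

namespace UniformHypergraph

variable {V : Type*} [DecidableEq V] {a b c : ℕ}

/-- The ternary relation of forming an edge. -/
def Edge (H : UniformHypergraph 3 V) (x y z : V) : Prop := {x, y, z} ∈ H.edges

lemma isSymmetric_edge (H : UniformHypergraph 3 V) : IsSymmetric H.Edge where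
  swap_left {x y z} h := by rwa [Edge, insert_comm]
  swap_right {x y z} h := by rwa [Edge, pair_comm]

/-- The elements of a sum of blocks without repetitions are covered by disjoint copies of the
complete tripartite `3`-graph. -/
lemma exists_tiling_of_mem_tileable {H : UniformHypergraph 3 V} {S : Finset V} {M : Multiset V}
    (hM : M ∈ tileable H.Edge a b c) : M.Nodup → (∀ x ∈ M, x ∈ S) →
      ∃ T : Set (Copy (completeTripartite a b c) (H.induce S)), IsTiling T ∧
        ⋃ φ ∈ T, φ.support = {x | x.1 ∈ M} := by
  induction hM using AddSubmonoid.closure_induction with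
  | mem M hM =>
    intro hnd hS
    obtain ⟨X, Y, Z, hX, hY, hZ, rfl, hE⟩ := hM
    obtain ⟨x, rfl⟩ := exists_tup_eq hX
    obtain ⟨y, rfl⟩ := exists_tup_eq hY
    obtain ⟨z, rfl⟩ := exists_tup_eq hZ
    set g : Fin a ⊕ Fin b ⊕ Fin c → V := Sum.elim x (Sum.elim y z)
    have hg : tup g = tup x + tup y + tup z := by
      simp [g, tup, Fintype.sum_sum_type, add_assoc]
    rw [← hg] at hnd hS ⊢
    have hinj := injective_of_nodup_tup hnd
    let φ : Copy (completeTripartite a b c) (H.induce S) :=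
      { toEmbedding := ⟨fun i => ⟨g i, hS _ (mem_tup.2 ⟨i, rfl⟩)⟩,
          fun i j hij => hinj (congrArg Subtype.val hij)⟩
        map_mem := by
          rintro e ⟨i, j, k, rfl⟩
          have := hE (x i) (mem_tup.2 ⟨i, rfl⟩) (y j) (mem_tup.2 ⟨j, rfl⟩) (z k)
            (mem_tup.2 ⟨k, rfl⟩)
          simp only [induce, Set.mem_ofPred_eq, Finset.map_insert, Finset.map_singleton]
          exact this }
    refine ⟨{φ}, by simp [IsTiling], ?_⟩
    ext v
    simp only [Set.mem_singleton_iff, Set.iUnion_iUnion_eq_left, Copy.support, Set.mem_range,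
      Set.mem_ofPred_eq, mem_tup]
    exact exists_congr fun i => Subtype.ext_iff
  | zero => exact fun _ _ => ⟨∅, by simp [IsTiling], by ext; simp⟩
  | add M N _ _ hM hN =>
    intro hnd hS
    obtain ⟨h1, h2, h3⟩ := Multiset.nodup_add.1 hnd
    obtain ⟨T₁, ht₁, hc₁⟩ := hM h1 fun x hx => hS x (Multiset.mem_add.2 (.inl hx))
    obtain ⟨T₂, ht₂, hc₂⟩ := hN h2 fun x hx => hS x (Multiset.mem_add.2 (.inr hx))
    refine ⟨T₁ ∪ T₂, ?_, ?_⟩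
    · refine ht₁.union ht₂ fun φ hφ ψ hψ _ => ?_
      refine Set.disjoint_left.2 fun v hv hv' => ?_
      have h4 : v ∈ ⋃ φ ∈ T₁, φ.support := Set.mem_biUnion hφ hv
      have h5 : v ∈ ⋃ φ ∈ T₂, φ.support := Set.mem_biUnion hψ hv'
      rw [hc₁] at h4
      rw [hc₂] at h5
      exact Multiset.disjoint_left.1 h3 h4 h5
    · rw [Set.biUnion_union, hc₁, hc₂]
      ext v
      simp

lemma hasFactor_induce {H : UniformHypergraph 3 V} {S : Finset V}
    (hS : S.val ∈ tileable H.Edge a b c) :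
    (completeTripartite a b c).HasFactor (H.induce S) := by
  obtain ⟨T, hT, hc⟩ := exists_tiling_of_mem_tileable (S := S) hS S.nodup fun x hx => hx
  refine ⟨T, hT, hc.trans ?_⟩
  ext x
  simp

variable [Fintype V]

/-- Each edge through `v` gives two ordered pairs in the link of `v`. -/
lemma two_mul_minDegree_le (H : UniformHypergraph 3 V) (v : V) :
    2 * (H.minDegree 1 : ℝ) ≤
      (density fun x : V × V => H.Edge v x.1 x.2) * (Fintype.card V) ^ 2 := by
  classical
  have : Nonempty V := ⟨v⟩
  have h1 : H.minDegree 1 ≤ H.degree {v} :=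
    ciInf_le (OrderBot.bddBelow _) (⟨{v}, card_singleton v⟩ : {S : Finset V // S.card = 1})
  set P := univ.filter fun x : V × V => H.Edge v x.1 x.2
  have h2 : (density fun x : V × V => H.Edge v x.1 x.2) = #P / (Fintype.card V : ℝ) ^ 2 := by
    rw [density_congr (q := fun x => x ∈ P) fun x => by simp [P], density_mem_finset]
    simp [sq]
  have hn : (0 : ℝ) < Fintype.card V := by exact_mod_cast Fintype.card_pos
  rw [h2, div_mul_cancel₀ _ (by positivity)]
  set F := univ.filter fun e => e ∈ H.edges ∧ {v} ⊆ e
  have h3 : H.degree {v} = #F := by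
    rw [degree, ← Set.ncard_coe_finset]
    simp [F]
  have h4 : #F * 2 ≤ #P := by
    refine card_mul_le_card_mul (fun e x => e = {v, x.1, x.2}) (m := 2) (n := 1) ?_ ?_ |>.trans_eq
      (mul_one _)
    · intro e he
      obtain ⟨he, hv⟩ := (mem_filter.1 he).2
      rw [singleton_subset_iff] at hv
      have h5 : #(e.erase v) = 2 := by rw [card_erase_of_mem hv, H.card_eq e he]
      obtain ⟨x, y, hxy, hexy⟩ := card_eq_two.1 h5
      have h6 : e = {v, x, y} := by rw [← insert_erase hv, hexy]
      have h7 : e = {v, y, x} := by rw [h6, pair_comm]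
      rw [← card_pair (show (x, y) ≠ (y, x) from fun h => hxy (congrArg Prod.fst h))]
      refine card_le_card fun p hp => ?_
      rw [bipartiteAbove, mem_filter]
      rcases mem_insert.1 hp with rfl | hp
      · exact ⟨mem_filter.2 ⟨mem_univ _, show {v, x, y} ∈ H.edges from h6 ▸ he⟩, h6⟩
      · rw [mem_singleton.1 hp]
        exact ⟨mem_filter.2 ⟨mem_univ _, show {v, y, x} ∈ H.edges from h7 ▸ he⟩, h7⟩
    · intro x _
      refine card_le_one.2 fun e he e' he' => ?_
      rw [(mem_filter.1 he).2, (mem_filter.1 he').2]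
  have h5 : H.minDegree 1 * 2 ≤ #P := (Nat.mul_le_mul_right 2 (h1.trans_eq h3)).trans h4
  rw [mul_comm]
  exact_mod_cast h5

end UniformHypergraph

/-- The error term in `n.choose 2 ≈ n ^ 2 / 2` is absorbed in half of `γ`. -/
lemma le_density_link {V : Type*} [Fintype V] [DecidableEq V] {H : UniformHypergraph 3 V}
    {f γ : ℝ} (hf : f ≤ 1) (hγ : 0 < γ) (hn : 2 * (1 + γ) / γ ≤ Fintype.card V)
    (h : (f + γ) * ((Fintype.card V).choose 2 : ℝ) ≤ H.minDegree 1) (v : V) :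
    f + γ / 2 ≤ density fun x : V × V => H.Edge v x.1 x.2 := by
  have : Nonempty V := ⟨v⟩
  have h1 := H.two_mul_minDegree_le v
  have h2 : (0 : ℝ) < Fintype.card V := by exact_mod_cast Fintype.card_pos
  rw [Nat.cast_choose_two] at h
  rw [div_le_iff₀ hγ] at hn
  generalize (density fun x : V × V => H.Edge v x.1 x.2) = d at *
  generalize (Fintype.card V : ℝ) = n at *
  have h3 : (f + γ / 2) * n ^ 2 ≤ (f + γ) * (n * (n - 1)) := by nlinarith
  nlinarith [pow_pos h2 2]

end Hypergraph

section Main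

lemma six_sub_le {a b c : ℕ} (ha : 2 ≤ a) : 6 - 4 * √2 ≤ absorbingDensity a b c := by
  have hs : (1.414 : ℝ) ≤ √2 := Real.le_sqrt_of_sq_le (by norm_num)
  unfold absorbingDensity
  split_ifs with h1
  · omega
  · exact le_rfl
  · linarith
  · linarith

lemma absorbingDensity_mem (a b c : ℕ) :
    1 / 4 ≤ absorbingDensity a b c ∧ absorbingDensity a b c ≤ 1 := by
  have hs : (1.414 : ℝ) ≤ √2 := Real.le_sqrt_of_sq_le (by norm_num)
  have hs2 : √2 ≤ 1.4143 := Real.sqrt_le_iff.2 (by norm_num)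
  unfold absorbingDensity
  split_ifs <;> constructor <;> linarith

lemma MostPairsExch.mono {a b c : ℕ} {δ δ' : ℝ} (h : MostPairsExch.{u} a b c δ) (hδ : δ ≤ δ') :
    MostPairsExch.{u} a b c δ' := fun ε hε => by
  obtain ⟨β, hβ, K, h⟩ := h ε hε
  exact ⟨β, hβ, K, fun V _ E hV hE hE' => h V E hV hE fun v => hδ.trans (hE' v)⟩

lemma mostPairsExch_absorbingDensity {a b c : ℕ} (ha : 1 ≤ a) (hab : a ≤ b) (hbc : b ≤ c) {γ : ℝ}
    (hγ : 0 < γ) : MostPairsExch.{u} a b c (absorbingDensity a b c + γ) := by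
  by_cases hd : Nat.gcd (b - a) (c - b) = 1
  · exact (cutsAreCrossed_of_coprime ha hab hbc hd hγ).mostPairsExch.mono
      (by linarith [(absorbingDensity_mem a b c).1])
  · unfold absorbingDensity
    rw [if_neg fun h => hd h.2.2, if_neg fun h => hd h.2.2]
    split_ifs with h
    · exact (cutsAreCrossed_of_odd ha hab hbc h.1 h.2.2 hγ).mostPairsExch
    · exact mostPairsExch_of_half ha hγ

/-- Every vertex is in many blocks. -/
lemma exists_density_block_at {a b c : ℕ} (ha : 1 ≤ a) {γ : ℝ} (hγ : 0 < γ) :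
    ∃ κ : ℝ, 0 < κ ∧ ∀ (V : Type u) [Fintype V] (E : V → V → V → Prop), IsSymmetric E →
      (∀ v, absorbingDensity a b c + γ ≤ density fun x : V × V => E v x.1 x.2) → ∀ v : V,
      κ ≤ density fun s : Fin (a - 1 + (b + c)) → V => {v} + tup s ∈ tileable E a b c := by
  obtain ⟨a, rfl⟩ : ∃ a', a = a' + 1 := ⟨a - 1, by omega⟩
  rcases Nat.eq_zero_or_pos a with rfl | ha'
  · have h1 := (absorbingDensity_mem (0 + 1) b c).1
    exact ⟨(absorbingDensity (0 + 1) b c + γ) ^ (b * c), pow_pos (by linarith) _,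
      fun V _ E _ hδ v => density_block_at_of_one (by linarith) (hδ v)⟩
  · refine ⟨(γ / 2 * (γ / 12) ^ 2) ^ ((a + 1) * b * c), by positivity, fun V _ E hE hδ v => ?_⟩
    have : Nonempty V := ⟨v⟩
    exact density_block_at_of_sqrt_two hE hγ
      (fun v => le_trans
        (by linarith [six_sub_le (a := a + 1) (b := b) (c := c) (by omega)]) (hδ v)) v

end Main

theorem lemma1p3 (a b c : ℕ) (ha : 1 ≤ a) (hab : a ≤ b) (hbc : b ≤ c) (γ : ℝ) (hγ : 0 < γ) :
    ∃ α : ℝ, 0 < α ∧ ∃ n₀ : ℕ, ∀ n : ℕ, n₀ ≤ n →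
      ∀ (V : Type*) [Fintype V] [DecidableEq V], Fintype.card V = n →
      ∀ H : UniformHypergraph 3 V,
        (absorbingDensity a b c + γ) * (n.choose 2 : ℝ) ≤ (H.minDegree 1 : ℝ) →
        ∃ W : Finset V, (W.card : ℝ) ≤ 1 / 4 * γ * n ∧
          ∀ U : Finset V, Disjoint U W → (U.card : ℝ) ≤ α * n → a + b + c ∣ U.card →
            (UniformHypergraph.completeTripartite a b c).HasFactor (H.induce W) ∧
            (UniformHypergraph.completeTripartite a b c).HasFactor (H.induce (W ∪ U)) := by
  obtain ⟨κ, hκ, hblock⟩ := exists_density_block_at (a := a) (b := b) (c := c) ha (half_pos hγ)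
  obtain ⟨β, hβ, k, hk, habs⟩ :=
    (mostPairsExch_absorbingDensity ha hab hbc (half_pos hγ)).absorbing ha hκ hblock
  obtain ⟨α, hα, n₁, hW⟩ := exists_absorbing_set (k := k) (m := a + b + c) hk (by omega) hβ
    (show 0 < 1 / 4 * γ by positivity)
  obtain ⟨n₂, hn₂⟩ := exists_nat_ge (2 * (1 + γ) / γ)
  refine ⟨α, hα, max 2 (max n₁ n₂), fun n hn V _ _ hV H hH => ?_⟩
  subst hV
  have hδ := le_density_link (absorbingDensity_mem a b c).2 hγ (hn₂.trans (by
    exact_mod_cast (le_max_right _ _).trans ((le_max_right _ _).trans hn))) hH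
  obtain ⟨W, hWc, hWC, hWU⟩ := hW V (tileable H.Edge a b c)
    ((le_max_left _ _).trans ((le_max_right _ _).trans hn))
    (habs V H.Edge ((le_max_left _ _).trans hn) H.isSymmetric_edge hδ)
  refine ⟨W, hWc, fun U hU hUc hdvd => ⟨UniformHypergraph.hasFactor_induce hWC,
    UniformHypergraph.hasFactor_induce ?_⟩⟩
  rw [← disjUnion_eq_union _ _ hU.symm]
  exact hWU U hUc hdvd
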